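/- Let $\mathbb{K}$ be a field of characteristic zero (for instance $\mathbb{K}=\mathbb{C}$) and let $S=\mathbb{K}[x_1,\dots,x_5,y_1,\dots,y_5,z_1,\dots,z_5]$ be the standard graded polynomial ring in the entries of the $3\times 5$ matrix of indeterminates $$M=\begin{pmatrix}x_1&x_2&x_3&x_4&x_5\\ y_1&y_2&y_3&y_4&y_5\\ z_1&z_2&z_3&z_4&z_5\end{pmatrix}.$$ Let $[a\,b\,c]$ denote the $3$-minor of $M$ on the columns $a<b<c$, and put $f_1=[1\,2\,3]$, $f_2=[1\,2\,4]$, $f_3=[1\,3\,4]$, $f_4=[2\,3\,4]$, $f_5=[1\,2\,5]$, $f_6=[1\,3\,5]$, $f_7=[2\,3\,5]$, $f_8=[1\,4\,5]$, $f_9=[2\,4\,5]$, $f_{10}=[3\,4\,5]$. For $j\in\{5,\dots,10\}$ let $F_j=f_1f_2f_3f_4f_j$. For a polynomial $f$ let $J_f$ be the ideal generated by its first partial derivatives. The Castelnuovo–Mumford regularity $\mathrm{reg}(S/J_f)$ of the Milnor algebra $S/J_f$ is $\sup\{a_{i,k}-i\}$, where $\bigoplus_k S(-a_{i,k})$ is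 the $i$-th module of the minimal graded free resolution of $S/J_f$ (so the zero module has regularity $-\infty$). A hypersurface $f=0$ in $\mathbb{P}^n$, with $f$ homogeneous of degree $d\ge 1$ and squarefree, is called free if the graded module of syzygies $\{(a_0,\dots,a_n): \sum_i a_i\,\partial_{x_i} f=0\}$ over the polynomial ring in the $n+1$ coordinates has a basis of homogeneous elements. It is not a cone if the first partial derivatives of $f$ are linearly independent over $\mathbb{K}$. Then: 1. For each $j\in\{5,\dots,10\}$ one has $\mathrm{reg}(S/J_{F_j})=13$, and $F_j=0$ is a free hypersurface of degree $15$ in $\mathbb{P}^{14}$ which is not a cone. 2. For all $n,d$, every free hypersurface $f=0$ of degree $d$ in $\mathbb{P}^n$ over $\mathbb{K}$ which is not a cone satisfies $\mathrm{reg}(\mathbb{K}[x_0,\dots,x_n]/J_f)\le 2d-n-3$. For $n=14$ and $d=15$ the bound in part 2 is $13$, so each $F_j$ attains the upper bound for the regularity of free hypersurfaces. -/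

import Mathlib

open MvPolynomial

namespace FreeHypersurface

universe u v

/-- The polynomial `p` is homogeneous of the integer degree `m`, that is, all its monomials have
total degree `m`. (So `0` is homogeneous of every degree, and is the only polynomial that is
homogeneous of a negative degree.) -/
def IsHomogeneousOfDegree {σ : Type u} {K : Type v} [Field K] (p : MvPolynomial σ K) (m : ℤ) :
    Prop :=
  ∀ s ∈ p.support, ((s.degree : ℕ) : ℤ) = m

/-- A graded free resolution
`⋯ → F₂ → F₁ → F₀ → S/I → 0`
of the quotient `S/I` of the polynomial ring `S = K[σ]` (with its standard grading), by finitely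
generated graded free modules `F_i = ⨁_k S(-a_{i,k})`; `a_{i,k} = shift i k` is the degree of the
`k`-th basis vector of `F_i`. All maps are graded of degree `0`. -/
structure GradedFreeResolution {σ : Type u} {K : Type v} [Field K]
    (I : Ideal (MvPolynomial σ K)) where
  /-- the rank of `F_i` -/
  rank : ℕ → ℕ
  /-- the degrees of the basis vectors of `F_i` -/
  shift : (i : ℕ) → Fin (rank i) → ℤ
  /-- the differential `F_{i+1} → F_i` -/
  diff : (i : ℕ) →
    (Fin (rank (i + 1)) → MvPolynomial σ K) →ₗ[MvPolynomial σ K] (Fin (rank i) → MvPolynomial σ K)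
  /-- the augmentation `F_0 → S/I` -/
  aug : (Fin (rank 0) → MvPolynomial σ K) →ₗ[MvPolynomial σ K] (MvPolynomial σ K ⧸ I)
  /-- the `(l, k)` entry of the matrix of `F_{i+1} → F_i` has degree `a_{i+1,k} - a_{i,l}` -/
  diff_homogeneous : ∀ (i : ℕ) (k : Fin (rank (i + 1))) (l : Fin (rank i)),
    IsHomogeneousOfDegree (diff i (Pi.single k 1) l) (shift (i + 1) k - shift i l)
  /-- the `k`-th basis vector of `F_0` goes to an element of degree `a_{0,k}` of `S/I` -/
  aug_homogeneous : ∀ k : Fin (rank 0), ∃ p : MvPolynomial σ K,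
    IsHomogeneousOfDegree p (shift 0 k) ∧ aug (Pi.single k 1) = Ideal.Quotient.mk I p
  aug_surjective : Function.Surjective aug
  exact_zero : LinearMap.range (diff 0) = LinearMap.ker aug
  exact_succ : ∀ i : ℕ, LinearMap.range (diff (i + 1)) = LinearMap.ker (diff i)

/-- A graded free resolution is minimal if the image of `F_{i+1} → F_i` lies in `𝔪 F_i` for all
`i`, where `𝔪` is the ideal generated by the variables; that is, all entries of the matrices of the
differentials have constant coefficient `0`. -/
def GradedFreeResolution.IsMinimal {σ : Type u} {K : Type v} [Field K]
    {I : Ideal (MvPolynomial σ K)} (R : GradedFreeResolution I) : Prop :=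
  ∀ (i : ℕ) (k : Fin (R.rank (i + 1))) (l : Fin (R.rank i)),
    constantCoeff (R.diff i (Pi.single k 1) l) = 0

/-- The Castelnuovo–Mumford regularity `reg(S/I)` of `S/I`, for a homogeneous ideal `I`: the
supremum of all `a_{i,k} - i` for the minimal graded free resolution of `S/I`, with
`F_i = ⨁_k S(-a_{i,k})`. The minimal resolution exists and is unique up to isomorphism, so the
infimum over all of them only serves to pick its value. The zero module has regularity `-∞`. -/
noncomputable def regularity {σ : Type u} {K : Type v} [Field K]
    (I : Ideal (MvPolynomial σ K)) : EReal :=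
  ⨅ (R : GradedFreeResolution I) (_ : R.IsMinimal),
    ⨆ (i : ℕ) (k : Fin (R.rank i)), (((R.shift i k - (i : ℤ) : ℤ) : ℝ) : EReal)

/-- The Jacobian ideal `J_f`, generated by the first partial derivatives of `f`.
The Milnor algebra of `f` is `S/J_f`. -/
noncomputable def jacobianIdeal {σ : Type u} {K : Type v} [Field K] (f : MvPolynomial σ K) :
    Ideal (MvPolynomial σ K) :=
  Ideal.span (Set.range fun v : σ => pderiv v f)

/-- The module `AR(f)` of all Jacobian syzygies of `f`: the tuples `(a_v)` of polynomials with
`∑ a_v ∂f/∂x_v = 0`. -/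
noncomputable def jacobianSyzygies {σ : Type u} [Fintype σ] {K : Type v} [Field K]
    (f : MvPolynomial σ K) : Submodule (MvPolynomial σ K) (σ → MvPolynomial σ K) where
  carrier := {a | ∑ v, a v * pderiv v f = 0}
  add_mem' := by
    intro a b ha hb
    simp only [Set.mem_ofPred_eq, Pi.add_apply, add_mul, Finset.sum_add_distrib] at *
    rw [ha, hb, add_zero]
  zero_mem' := by simp
  smul_mem' := by
    intro c a ha
    simp only [Set.mem_ofPred_eq, Pi.smul_apply, smul_eq_mul, mul_assoc] at *
    rw [← Finset.mul_sum, ha, mul_zero]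

/-- The equation `f = 0` defines a reduced free hypersurface of degree `d ≥ 1` in the projective
space with homogeneous coordinates `x_v`, `v ∈ σ`: the polynomial `f` is homogeneous of degree `d`
and squarefree, and the graded module `AR(f)` is free, with a basis of homogeneous syzygies
(whose degrees `e_k` are the exponents). -/
structure IsFreeHypersurface {σ : Type u} [Fintype σ] {K : Type v} [Field K]
    (f : MvPolynomial σ K) (d : ℕ) : Prop where
  pos : 1 ≤ d
  homogeneous : f.IsHomogeneous d
  reduced : Squarefree f
  free : ∃ (m : ℕ) (e : Fin m → ℕ)
    (b : Module.Basis (Fin m) (MvPolynomial σ K) (jacobianSyzygies f)),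
    ∀ (k : Fin m) (v : σ),
      ((b k : σ → MvPolynomial σ K) v).IsHomogeneous (e k)

/-- `f` is not a cone, that is, no linear change of coordinates turns `f` into a polynomial in
fewer variables: no nontrivial constant vector field kills `f`, which says that the first partial
derivatives of `f` are linearly independent over `K`. -/
def IsNotCone {σ : Type u} {K : Type v} [Field K] (f : MvPolynomial σ K) : Prop :=
  LinearIndependent K fun v : σ => pderiv v f

/-- The columns (counted from `0`) of the generic `3 × 5` matrix that enter the `l`-th minor,
`1 ≤ l ≤ 10`. -/
def minorColumns : ℕ → Fin 3 → Fin 5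
  | 1 => ![0, 1, 2]
  | 2 => ![0, 1, 3]
  | 3 => ![0, 2, 3]
  | 4 => ![1, 2, 3]
  | 5 => ![0, 1, 4]
  | 6 => ![0, 2, 4]
  | 7 => ![1, 2, 4]
  | 8 => ![0, 3, 4]
  | 9 => ![1, 3, 4]
  | 10 => ![2, 3, 4]
  | _ => ![0, 0, 0]

/-- The `3`-minor `f_l`, `1 ≤ l ≤ 10`, of the `3 × 5` matrix of indeterminates. The
indeterminates `x_c`, `y_c`, `z_c` of the `c`-th column are `X (0, c-1)`, `X (1, c-1)`,
`X (2, c-1)`. -/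
noncomputable def minor (K : Type v) [Field K] (l : ℕ) : MvPolynomial (Fin 3 × Fin 5) K :=
  ((Matrix.mvPolynomialX (Fin 3) (Fin 5) K).submatrix id (minorColumns l)).det

/-- The polynomial `F_j = f₁ f₂ f₃ f₄ f_j`. -/
noncomputable def arrangement (K : Type v) [Field K] (j : ℕ) : MvPolynomial (Fin 3 × Fin 5) K :=
  minor K 1 * minor K 2 * minor K 3 * minor K 4 * minor K j

end FreeHypersurface

/-! Upper bound. Over a free hypersurface of degree `d` in `ℙⁿ`, a homogeneous basis of the Jacobian
syzygies, with degrees `e_k`, gives the resolution `0 → ⨁ S(-(d-1+e_k)) → S(-(d-1))^(n+1) → S`. If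
`f` is not a cone and `d ≥ 2` it is minimal, since then every `e_k ≥ 1`. There are `n` exponents
(`card_eq_of_basis`), and they add up to `d - 1` (`sum_exponents`), so each is at most `d - n`. The
last module contributes at most `(d - 1) + (d - n) - 2 = 2d - n - 3`, and the other two contribute
no more than that.

Sum of exponents. The Euler field and the basis form a square matrix whose determinant is a unit
times `f`. Divisibility by `f` holds for any logarithmic rows (`dvd_det_of_dvd_mulVec_grad`); a
further prime factor is excluded by reducing modulo it.

The arrangements. Row operations, scalings of the first four columns, and additions of two columns
of the fifth minor to the last column are `9 + 4 + 2 = 15` linear logarithmic fields, independent at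
a general point. Saito's criterion then makes `F_j` free with all exponents `1`. The upper bound
gives `13`; the Jacobian ideal has generators of degree `14`, which forces regularity at least `13`.
-/

namespace FreeHypersurface

open Matrix

/-! ### Squarefree polynomials and their partial derivatives. -/

section Squarefree

variable {σ K : Type*} [Field K]

theorem exists_pderiv_ne_zero [CharZero K] {p : MvPolynomial σ K} (h0 : p ≠ 0)
    (hp : ¬ IsUnit p) : ∃ v, pderiv v p ≠ 0 := by
  classical
  by_contra! h
  apply hp
  have hC : p = C (coeff 0 p) := by
    ext m
    rw [coeff_C]
    split_ifs with hm
    · rw [hm]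
    · obtain ⟨v, hv⟩ : ∃ v, m v ≠ 0 := by
        by_contra! hv
        exact hm (Finsupp.ext fun v => (hv v).symm)
      have h1 := coeff_pderiv (i := v) p (m - Finsupp.single v 1)
      rw [h v, coeff_zero, tsub_add_cancel_of_le (by
        rw [Finsupp.single_le_iff]; exact Nat.one_le_iff_ne_zero.mpr hv)] at h1
      have h2 : ((m - Finsupp.single v 1 : σ →₀ ℕ) v : K) + 1 ≠ 0 := Nat.cast_add_one_ne_zero _
      exact (mul_eq_zero.mp h1.symm).resolve_right h2
  rw [hC]
  refine (isUnit_iff_ne_zero.mpr fun h1 => h0 ?_).map C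
  rw [hC, h1, C_0]

theorem degreeOf_pderiv_lt {p : MvPolynomial σ K} {v : σ} (h : pderiv v p ≠ 0) :
    degreeOf v (pderiv v p) < degreeOf v p := by
  have key : ∀ m ∈ (pderiv v p).support, m v + 1 ≤ degreeOf v p := by
    intro m hm
    rw [mem_support_iff, coeff_pderiv] at hm
    have h1 := monomial_le_degreeOf v (mem_support_iff.mpr (left_ne_zero_of_mul hm))
    simpa using h1
  obtain ⟨m, hm⟩ := support_nonempty.mpr h
  rw [degreeOf_lt_iff (by have := key m hm; omega)]
  exact fun m hm => key m hm

theorem not_dvd_pderiv {p : MvPolynomial σ K} {v : σ} (h : pderiv v p ≠ 0) :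
    ¬ p ∣ pderiv v p := by
  rintro ⟨q, hq⟩
  have h1 := degreeOf_pderiv_lt h
  rw [hq] at h h1
  rw [degreeOf_mul_eq (left_ne_zero_of_mul h) (right_ne_zero_of_mul h)] at h1
  omega

theorem squarefree_dvd_of_forall_prime {R : Type*} [CommRing R] [IsDomain R]
    [UniqueFactorizationMonoid R] {f g : R} (hf : Squarefree f)
    (h : ∀ p, Prime p → p ∣ f → p ∣ g) : f ∣ g := by
  induction f using UniqueFactorizationMonoid.induction_on_prime with
  | h₁ => exact absurd hf not_squarefree_zero
  | h₂ x hx => exact hx.dvd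
  | h₃ a p ha hp ih =>
    obtain ⟨k, rfl⟩ := ih (hf.squarefree_of_dvd (dvd_mul_left a p))
      fun q hq hqa => h q hq (hqa.mul_left p)
    rcases hp.dvd_or_dvd (h p hp (dvd_mul_right p a)) with h1 | ⟨c, rfl⟩
    · exact absurd (hf p (mul_dvd_mul_left p h1)) hp.not_isUnit
    · exact ⟨c, by ring⟩

/-- The partial derivatives of a squarefree polynomial have no common factor with it. -/
theorem dvd_of_forall_dvd_mul_pderiv [CharZero K] {f g : MvPolynomial σ K} (hf : Squarefree f)
    (h : ∀ v, f ∣ g * pderiv v f) : f ∣ g := by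
  refine squarefree_dvd_of_forall_prime hf fun p hp hpf => ?_
  obtain ⟨q, rfl⟩ := hpf
  obtain ⟨v, hv⟩ := exists_pderiv_ne_zero hp.ne_zero hp.not_isUnit
  -- For `f = p q`, modulo `p` the derivative of `f` is `q * pderiv v p`, and `p` divides neither
  -- factor.
  have h1 : p ∣ g * (q * pderiv v p) := by
    have h2 := (dvd_mul_right p q).trans (h v)
    rw [pderiv_mul, mul_add] at h2
    rw [← dvd_add_left (dvd_mul_of_dvd_right (dvd_mul_right p (pderiv v q)) g)]
    convert h2 using 2
    ring
  rcases hp.dvd_or_dvd h1 with h2 | h2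
  · exact h2
  rcases hp.dvd_or_dvd h2 with h3 | h3
  · exact absurd (hf p (mul_dvd_mul_left p h3)) hp.not_isUnit
  · exact absurd h3 (not_dvd_pderiv hv)

end Squarefree

/-! ### Matrices with a distinguished top row. -/

section ConsRows

variable {σ R : Type*}

/-- The square matrix with top row `x` and further rows `b`, where `e` numbers the rows. -/
def consRows {m : ℕ} (e : σ ≃ Fin (m + 1)) (x : σ → R) (b : Fin m → σ → R) : Matrix σ σ R :=
  Matrix.of fun i => (Fin.cons x b : Fin (m + 1) → σ → R) (e i)

theorem consRows_zero {m : ℕ} (e : σ ≃ Fin (m + 1)) (x : σ → R) (b : Fin m → σ → R)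
    (j : σ) : consRows e x b (e.symm 0) j = x j := by
  simp [consRows]

theorem consRows_succ {m : ℕ} (e : σ ≃ Fin (m + 1)) (x : σ → R) (b : Fin m → σ → R)
    (k : Fin m) (j : σ) : consRows e x b (e.symm k.succ) j = b k j := by
  simp [consRows]

theorem updateRow_consRows [DecidableEq σ] {m : ℕ} (e : σ ≃ Fin (m + 1)) (x y : σ → R)
    (b : Fin m → σ → R) : (consRows e y b).updateRow (e.symm 0) x = consRows e x b := by
  ext i j
  obtain ⟨k, rfl⟩ := e.symm.surjective i
  refine Fin.cases ?_ (fun k => ?_) k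
  · rw [updateRow_self, consRows_zero]
  · rw [updateRow_ne (by simp), consRows_succ, consRows_succ]

/-- Laplace expansion along the top row: the cofactors do not involve that row, so they can be read
off with any `y` in place of `x`. -/
theorem det_consRows [Fintype σ] [DecidableEq σ] [CommRing R] {m : ℕ} (e : σ ≃ Fin (m + 1))
    (x y : σ → R) (b : Fin m → σ → R) :
    (consRows e x b).det = ∑ v, (consRows e y b).adjugate v (e.symm 0) * x v := by
  rw [← updateRow_consRows e x y b, ← cramer_transpose_apply, cramer_eq_adjugate_mulVec,
    ← adjugate_transpose]
  rfl

theorem map_consRows {S : Type*} {m : ℕ} (g : R → S) (e : σ ≃ Fin (m + 1)) (x : σ → R)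
    (b : Fin m → σ → R) :
    (consRows e x b).map g = consRows e (fun v => g (x v)) fun k v => g (b k v) := by
  ext i j
  obtain ⟨k, rfl⟩ := e.symm.surjective i
  refine Fin.cases ?_ (fun k => ?_) k <;> simp [consRows]

end ConsRows

theorem det_isHomogeneous {ι σ K : Type*} [Fintype ι] [DecidableEq ι] [Field K]
    {B : Matrix ι ι (MvPolynomial σ K)} {r : ι → ℕ}
    (h : ∀ i j, (B i j).IsHomogeneous (r i)) : B.det.IsHomogeneous (∑ i, r i) := by
  rw [det_apply]
  refine IsHomogeneous.sum _ _ _ fun τ _ => ?_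
  have h1 := IsHomogeneous.prod Finset.univ (fun i => B (τ i) i) (fun i => r (τ i))
    fun i _ => h _ _
  rw [Equiv.sum_comp τ r] at h1
  rw [Units.smul_def, ← mem_homogeneousSubmodule] at *
  exact zsmul_mem h1 _

/-! ### The exponents: their number, positivity and sum. -/

section Saito

variable {σ K : Type*} [Fintype σ] [Field K]

/-- The gradient of `f`. -/
noncomputable def grad (f : MvPolynomial σ K) : σ → MvPolynomial σ K := fun v => pderiv v f

theorem mem_jacobianSyzygies {f : MvPolynomial σ K} {a : σ → MvPolynomial σ K} :
    a ∈ jacobianSyzygies f ↔ a ⬝ᵥ grad f = 0 := Iff.rfl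

theorem linearIndependent_cons_X [CharZero K] {f : MvPolynomial σ K} {d m : ℕ} (hd : 1 ≤ d)
    (hf : f.IsHomogeneous d) (hf0 : f ≠ 0)
    (b : Module.Basis (Fin m) (MvPolynomial σ K) (jacobianSyzygies f)) :
    LinearIndependent (MvPolynomial σ K)
      (Fin.cons X (fun k => (b k : σ → MvPolynomial σ K)) :
        Fin (m + 1) → σ → MvPolynomial σ K) := by
  rw [Fintype.linearIndependent_iff]
  intro g hg
  rw [Fin.sum_univ_succ] at hg
  simp only [Fin.cons_zero, Fin.cons_succ] at hg
  have hsum : (∑ k : Fin m, g k.succ • (b k : σ → MvPolynomial σ K)) ⬝ᵥ grad f = 0 :=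
    mem_jacobianSyzygies.mp (Submodule.sum_mem _ fun k _ => Submodule.smul_mem _ _ (b k).2)
  have hE : (X : σ → MvPolynomial σ K) ⬝ᵥ grad f = d • f := hf.sum_X_mul_pderiv
  have h0 : g 0 = 0 := by
    have h1 := congrArg (· ⬝ᵥ grad f) hg
    simp only [add_dotProduct, smul_dotProduct, zero_dotProduct, hsum, add_zero, hE,
      smul_eq_mul, nsmul_eq_mul] at h1
    have h2 : (d : MvPolynomial σ K) ≠ 0 := Nat.cast_ne_zero.mpr (by omega)
    simpa [h2, hf0] using h1
  rw [h0, zero_smul, zero_add] at hg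
  have hb := b.linearIndependent.map' (Submodule.subtype _) (Submodule.ker_subtype _)
  have h2 := Fintype.linearIndependent_iff.mp hb (fun k => g k.succ) hg
  exact Fin.cases h0 h2

/-- Rank-nullity for pairing with the gradient, whose image is a nonzero ideal and so has rank one.
-/
theorem card_eq_of_basis {f : MvPolynomial σ K} {m : ℕ} (hf : grad f ≠ 0)
    (b : Module.Basis (Fin m) (MvPolynomial σ K) (jacobianSyzygies f)) :
    Fintype.card σ = m + 1 := by
  classical
  let φ : (σ → MvPolynomial σ K) →ₗ[MvPolynomial σ K] MvPolynomial σ K :=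
    { toFun := fun a => a ⬝ᵥ grad f
      map_add' := fun a c => add_dotProduct _ _ _
      map_smul' := fun a c => smul_dotProduct _ _ _ }
  have hker : LinearMap.ker φ = jacobianSyzygies f := rfl
  have h1 := (LinearMap.ker φ).finrank_quotient_add_finrank
  rw [φ.quotKerEquivRange.finrank_eq, hker, Module.finrank_eq_card_basis b, Fintype.card_fin,
    Module.finrank_fintype_fun_eq_card] at h1
  have h2 : Module.finrank (MvPolynomial σ K) (LinearMap.range φ) ≤ 1 :=
    (Submodule.finrank_le _).trans (Module.finrank_self _).le
  have h3 : Module.finrank (MvPolynomial σ K) (LinearMap.range φ) ≠ 0 := by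
    intro h
    rw [Submodule.finrank_eq_zero, LinearMap.range_eq_bot] at h
    refine hf (funext fun v => ?_)
    have := LinearMap.congr_fun h (Pi.single v 1)
    simpa [φ] using this
  omega

/-- Reductions of the members of a basis of the Jacobian syzygies modulo a prime polynomial stay
linearly independent. -/
theorem linearIndependent_mk_basis {f π : MvPolynomial σ K} {m : ℕ} (hπ : π ≠ 0)
    (b : Module.Basis (Fin m) (MvPolynomial σ K) (jacobianSyzygies f)) :
    LinearIndependent (MvPolynomial σ K ⧸ Ideal.span {π})
      (fun (k : Fin m) (v : σ) => Ideal.Quotient.mk (Ideal.span {π})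
        ((b k : σ → MvPolynomial σ K) v)) := by
  rw [Fintype.linearIndependent_iff]
  intro c hc k
  choose g hg using fun k => Ideal.Quotient.mk_surjective (c k)
  obtain rfl : (fun k => Ideal.Quotient.mk (Ideal.span {π}) (g k)) = c := funext hg
  have h1 : ∀ v, π ∣ ∑ k, g k * (b k : σ → MvPolynomial σ K) v := by
    intro v
    have := congrFun hc v
    simp only [Finset.sum_apply, Pi.smul_apply, smul_eq_mul, ← map_mul, ← map_sum,
      Pi.zero_apply] at this
    exact Ideal.mem_span_singleton.mp (Ideal.Quotient.eq_zero_iff_mem.mp this)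
  choose w hw using h1
  have hsum : ((∑ k, g k • b k : jacobianSyzygies f) : σ → MvPolynomial σ K) = π • w := by
    ext1 v
    simp [hw]
  -- The syzygy module is saturated: its defining equation can be divided by `π`.
  have hwm : w ∈ jacobianSyzygies f := by
    have h2 := mem_jacobianSyzygies.mp (∑ k, g k • b k : jacobianSyzygies f).2
    rw [hsum, smul_dotProduct, smul_eq_mul] at h2
    exact (mul_eq_zero.mp h2).resolve_left hπ
  have h3 : ∑ k, g k • b k = π • (⟨w, hwm⟩ : jacobianSyzygies f) := Subtype.ext hsum
  have h4 := congrArg (fun x => b.repr x k) h3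
  simp only [b.repr_sum_self, map_smul, Finsupp.smul_apply, smul_eq_mul] at h4
  rw [Ideal.Quotient.eq_zero_iff_mem, Ideal.mem_span_singleton, h4]
  exact dvd_mul_right _ _

/-- The exponents of a free hypersurface that is not a cone are positive. -/
theorem exponent_pos {f : MvPolynomial σ K} (hcone : IsNotCone f) {m : ℕ} {e : Fin m → ℕ}
    (b : Module.Basis (Fin m) (MvPolynomial σ K) (jacobianSyzygies f))
    (he : ∀ k v, ((b k : σ → MvPolynomial σ K) v).IsHomogeneous (e k)) (k : Fin m) :
    1 ≤ e k := by
  by_contra! h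
  have h0 : ∀ v, (b k : σ → MvPolynomial σ K) v =
      C (coeff 0 ((b k : σ → MvPolynomial σ K) v)) := by
    intro v
    have h1 := he k v
    rw [Nat.lt_one_iff.mp h] at h1
    exact totalDegree_eq_zero_iff_eq_C.mp ((totalDegree_zero_iff_isHomogeneous _).mpr h1)
  have h1 := mem_jacobianSyzygies.mp (b k).2
  have h2 := Fintype.linearIndependent_iff.mp hcone
    (fun v => coeff 0 ((b k : σ → MvPolynomial σ K) v)) (by
      rw [← h1]
      refine Finset.sum_congr rfl fun v _ => ?_
      rw [smul_eq_C_mul, ← h0]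
      rfl)
  refine b.ne_zero k (Subtype.ext (funext fun v => ?_))
  rw [h0, h2, C_0]
  rfl

variable [DecidableEq σ]

theorem det_mul_eq_adjugate_mulVec {R : Type*} [CommRing R] (B : Matrix σ σ R) (g : σ → R)
    (v : σ) : B.det * g v = (B.adjugate *ᵥ (B *ᵥ g)) v := by
  rw [mulVec_mulVec, adjugate_mul, smul_mulVec, one_mulVec]
  rfl

/-- If the rows of `B` are logarithmic vector fields along `f = 0`, then `f` divides `det B`. -/
theorem dvd_det_of_dvd_mulVec_grad [CharZero K] {f : MvPolynomial σ K} (hf : Squarefree f)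
    {B : Matrix σ σ (MvPolynomial σ K)} (h : ∀ i, f ∣ (B *ᵥ grad f) i) : f ∣ B.det := by
  refine dvd_of_forall_dvd_mul_pderiv hf fun v => ?_
  change f ∣ B.det * grad f v
  rw [det_mul_eq_adjugate_mulVec]
  exact Finset.dvd_sum fun i _ => (h i).mul_left _

theorem det_ne_zero_of_linearIndependent {R : Type*} [CommRing R] [IsDomain R]
    {B : Matrix σ σ R} (h : LinearIndependent R B) : B.det ≠ 0 := by
  intro h0
  obtain ⟨v, hv, hv0⟩ := exists_vecMul_eq_zero_iff.mpr h0
  refine hv (funext (Fintype.linearIndependent_iff.mp h v ?_))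
  rw [← hv0]
  ext j
  simp [vecMul, dotProduct]

/-- The exponents of a free hypersurface of degree `d` add up to `d - 1`. -/
theorem sum_exponents [CharZero K] {f : MvPolynomial σ K} {d m : ℕ} (hd : 1 ≤ d)
    (hf : f.IsHomogeneous d) (hsq : Squarefree f) (e : Fin m → ℕ)
    (b : Module.Basis (Fin m) (MvPolynomial σ K) (jacobianSyzygies f))
    (he : ∀ k v, ((b k : σ → MvPolynomial σ K) v).IsHomogeneous (e k))
    (hcard : Fintype.card σ = m + 1) : 1 + ∑ k, e k = d := by
  have hf0 : f ≠ 0 := hsq.ne_zero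
  let ε : σ ≃ Fin (m + 1) := Fintype.equivFinOfCardEq hcard
  set A := consRows ε X (fun k => (b k : σ → MvPolynomial σ K)) with hA
  have hdu : IsUnit (d : MvPolynomial σ K) := by
    rw [← map_natCast C d]
    exact (isUnit_iff_ne_zero.mpr (Nat.cast_ne_zero.mpr (by omega))).map C
  have hE : (X : σ → MvPolynomial σ K) ⬝ᵥ grad f = d * f := by
    rw [← nsmul_eq_mul]; exact hf.sum_X_mul_pderiv
  have hAg : A *ᵥ grad f = Pi.single (ε.symm 0) (d * f) := by
    ext1 i
    obtain ⟨k, rfl⟩ := ε.symm.surjective i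
    refine Fin.cases ?_ (fun k => ?_) k
    · simpa only [Pi.single_eq_same, mulVec, hA, consRows_zero] using hE
    · rw [Pi.single_eq_of_ne (by simp)]
      simpa only [mulVec, hA, consRows_succ] using mem_jacobianSyzygies.mp (b k).2
  have hdet0 : A.det ≠ 0 := det_ne_zero_of_linearIndependent
    ((linearIndependent_cons_X hd hf hf0 b).comp _ ε.injective)
  have hadj : ∀ v, A.det * grad f v = A.adjugate v (ε.symm 0) * (d * f) := by
    intro v
    rw [det_mul_eq_adjugate_mulVec, hAg, mulVec_single]
    rfl
  obtain ⟨p, hp⟩ : f ∣ A.det := by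
    refine dvd_det_of_dvd_mulVec_grad hsq fun i => ?_
    rw [hAg]
    by_cases hi : i = ε.symm 0
    · subst hi
      simp
    · simp [hi]
  -- A prime `π` dividing `p` would divide all cofactors of the Euler row. Modulo `π` the basis rows
  -- stay independent and can be completed by a row `x` to a nonsingular matrix, but its determinant
  -- expands in those vanishing cofactors.
  have hpu : IsUnit p := by
    by_contra hpu
    have hp0 : p ≠ 0 := by
      rintro rfl
      exact hdet0 (by rw [hp, mul_zero])
    obtain ⟨π, hπ, hπp⟩ := WfDvdMonoid.exists_irreducible_factor hpu hp0
    have hprime : Prime π := hπ.prime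
    have hdvd : ∀ v, π ∣ A.adjugate v (ε.symm 0) := by
      intro v
      have h1 : f * (p * grad f v) = f * (A.adjugate v (ε.symm 0) * d) := by
        rw [← mul_assoc, ← hp, hadj]; ring
      rw [← hdu.dvd_mul_right, ← mul_left_cancel₀ hf0 h1]
      exact hπp.mul_right _
    have hId : (Ideal.span {π}).IsPrime := (Ideal.span_singleton_prime hprime.ne_zero).mpr hprime
    have hli := linearIndependent_mk_basis hprime.ne_zero b
    obtain ⟨x, hx⟩ := exists_linearIndependent_cons_of_lt_finrank hli (by
      rw [Module.finrank_fintype_fun_eq_card, hcard]; exact Nat.lt_succ_self m)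
    refine det_ne_zero_of_linearIndependent (hx.comp _ ε.injective) ?_
    change (consRows ε x _).det = 0
    rw [det_consRows ε x (fun v => Ideal.Quotient.mk (Ideal.span {π}) (X v)),
      ← map_consRows (Ideal.Quotient.mk (Ideal.span {π}))]
    refine Finset.sum_eq_zero fun v _ => ?_
    have h2 := RingHom.map_adjugate (Ideal.Quotient.mk (Ideal.span {π})) A
    rw [RingHom.mapMatrix_apply, RingHom.mapMatrix_apply] at h2
    rw [← hA, ← h2, Matrix.map_apply, Ideal.Quotient.eq_zero_iff_mem.mpr
      (Ideal.mem_span_singleton.mpr (hdvd v)), zero_mul]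
  have hAh : A.det.IsHomogeneous (∑ i, (Fin.cons 1 e : Fin (m + 1) → ℕ) (ε i)) := by
    refine det_isHomogeneous fun i j => ?_
    obtain ⟨k, rfl⟩ := ε.symm.surjective i
    refine Fin.cases ?_ (fun k => ?_) k
    · rw [hA, consRows_zero]
      simpa using isHomogeneous_X K j
    · rw [hA, consRows_succ]
      simpa using he k j
  rw [Equiv.sum_comp ε (Fin.cons 1 e : Fin (m + 1) → ℕ), Fin.sum_univ_succ, Fin.cons_zero] at hAh
  simp only [Fin.cons_succ] at hAh
  have hdeg := hAh.totalDegree hdet0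
  -- The determinant has degree `1 + ∑ e_k`, and it is a constant multiple of `f`.
  obtain ⟨r, hr, rfl⟩ := isUnit_iff_eq_C_of_isReduced.mp hpu
  rw [← hdeg, hp, mul_comm, ← hf.totalDegree hf0]
  exact (hf.C_mul r).totalDegree (by
    rw [mul_comm, ← hp]; exact hdet0) |>.trans (hf.totalDegree hf0).symm

end Saito

/-! ### The resolution of the Milnor algebra and bounds on the regularity. -/

section Regularity

variable {σ K : Type*} [Field K]

theorem isHomogeneousOfDegree_of_isHomogeneous {p : MvPolynomial σ K} {n : ℕ} {m : ℤ}
    (h : p.IsHomogeneous n) (hm : (n : ℤ) = m) : IsHomogeneousOfDegree p m := fun _ hs => by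
  rw [← hm]
  by_contra hne
  exact mem_support_iff.mp hs (h.coeff_eq_zero fun h' => hne (congrArg Nat.cast h'))

/-- The regularity is an infimum over minimal resolutions, so a single one bounds it from above. -/
theorem regularity_le {I : Ideal (MvPolynomial σ K)} (R : GradedFreeResolution I)
    (hR : R.IsMinimal) {c : ℤ} (h : ∀ i k, R.shift i k - i ≤ c) :
    regularity I ≤ ((c : ℝ) : EReal) :=
  iInf₂_le_of_le R hR <| iSup₂_le fun i k => by exact_mod_cast h i k

/-- The resolution of the zero module by zero modules. -/
noncomputable def zeroResolution : GradedFreeResolution (⊤ : Ideal (MvPolynomial σ K)) where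
  rank _ := 0
  shift _ _ := 0
  diff _ := 0
  aug := 0
  diff_homogeneous _ k := k.elim0
  aug_homogeneous k := k.elim0
  aug_surjective _ := ⟨0, (Ideal.Quotient.subsingleton_iff.mpr rfl).elim _ _⟩
  exact_zero := Subsingleton.elim _ _
  exact_succ _ := Subsingleton.elim _ _

theorem regularity_top_le (c : ℤ) :
    regularity (⊤ : Ideal (MvPolynomial σ K)) ≤ ((c : ℝ) : EReal) :=
  regularity_le zeroResolution (fun _ k => k.elim0) fun _ k => k.elim0

section FreeResolution

variable {f : MvPolynomial σ K} {m N : ℕ}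

/-- The map `S^N → S` given by the partial derivatives of `f`. -/
noncomputable def gradMap (f : MvPolynomial σ K) (ε : σ ≃ Fin N) :
    (Fin N → MvPolynomial σ K) →ₗ[MvPolynomial σ K] (Fin 1 → MvPolynomial σ K) :=
  LinearMap.pi fun _ => Fintype.linearCombination (MvPolynomial σ K) fun l => pderiv (ε.symm l) f

theorem gradMap_single (ε : σ ≃ Fin N) (l : Fin N) (k : Fin 1) :
    gradMap f ε (Pi.single l 1) k = pderiv (ε.symm l) f := by
  simp [gradMap, Fintype.linearCombination_apply_single]

theorem exists_isHomogeneousOfDegree_zero (I : Ideal (MvPolynomial σ K)) (k : Fin 1) :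
    ∃ p : MvPolynomial σ K, IsHomogeneousOfDegree p 0 ∧
      (I.mkQ ∘ₗ LinearMap.proj (φ := fun _ : Fin 1 => MvPolynomial σ K) 0) (Pi.single k 1) =
        Ideal.Quotient.mk I p := by
  refine ⟨1, isHomogeneousOfDegree_of_isHomogeneous (isHomogeneous_one σ K) rfl, ?_⟩
  rw [Subsingleton.elim k 0, LinearMap.comp_apply, LinearMap.proj_apply, Pi.single_eq_same]
  rfl

theorem gradMap_isHomogeneousOfDegree (ε : σ ≃ Fin N) {d : ℕ} (hd : 1 ≤ d)
    (hf : f.IsHomogeneous d) (l : Fin N) (k : Fin 1) :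
    IsHomogeneousOfDegree (gradMap f ε (Pi.single l 1) k) ((d : ℤ) - 1 - 0) := by
  rw [gradMap_single]
  exact isHomogeneousOfDegree_of_isHomogeneous hf.pderiv (by omega)

theorem constantCoeff_gradMap (ε : σ ≃ Fin N) {d : ℕ} (hd : 2 ≤ d) (hf : f.IsHomogeneous d)
    (l : Fin N) (k : Fin 1) : constantCoeff (gradMap f ε (Pi.single l 1) k) = 0 := by
  rw [gradMap_single]
  exact hf.pderiv.coeff_eq_zero (by simp; omega)

variable [Fintype σ]

theorem gradMap_apply (ε : σ ≃ Fin N) (a : Fin N → MvPolynomial σ K) (k : Fin 1) :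
    gradMap f ε a k = ∑ v, a (ε v) * pderiv v f := by
  simp [gradMap, Fintype.linearCombination_apply, ← Equiv.sum_comp ε]

theorem mem_range_gradMap_iff (ε : σ ≃ Fin N) (x : Fin 1 → MvPolynomial σ K) :
    x ∈ LinearMap.range (gradMap f ε) ↔ x 0 ∈ jacobianIdeal f := by
  rw [jacobianIdeal, Ideal.mem_span_range_iff_exists_fun]
  constructor
  · rintro ⟨a, rfl⟩
    exact ⟨fun v => a (ε v), (gradMap_apply ε a 0).symm⟩
  · rintro ⟨c, hc⟩
    refine ⟨fun l => c (ε.symm l), funext fun k => ?_⟩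
    rw [Subsingleton.elim k 0, ← hc, gradMap_apply]
    simp only [Equiv.symm_apply_apply]

theorem range_gradMap (ε : σ ≃ Fin N) : LinearMap.range (gradMap f ε) =
    LinearMap.ker ((jacobianIdeal f).mkQ ∘ₗ
      LinearMap.proj (φ := fun _ : Fin 1 => MvPolynomial σ K) 0) := by
  ext x
  rw [mem_range_gradMap_iff, LinearMap.mem_ker, LinearMap.comp_apply, LinearMap.proj_apply,
    Submodule.mkQ_apply, Submodule.Quotient.mk_eq_zero]

theorem mem_ker_gradMap_iff (ε : σ ≃ Fin N) (a : Fin N → MvPolynomial σ K) :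
    a ∈ LinearMap.ker (gradMap f ε) ↔ (fun v => a (ε v)) ∈ jacobianSyzygies f := by
  rw [LinearMap.mem_ker, mem_jacobianSyzygies, funext_iff]
  simp only [gradMap_apply, dotProduct, grad]
  exact ⟨fun h => h 0, fun h _ => h⟩

/-- The map `S^m → S^N` whose columns are the members of a basis of the Jacobian syzygies. -/
noncomputable def syzygyMap (ε : σ ≃ Fin N)
    (b : Module.Basis (Fin m) (MvPolynomial σ K) (jacobianSyzygies f)) :
    (Fin m → MvPolynomial σ K) →ₗ[MvPolynomial σ K] (Fin N → MvPolynomial σ K) :=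
  Fintype.linearCombination (MvPolynomial σ K) fun k l => (b k : σ → MvPolynomial σ K) (ε.symm l)

variable (b : Module.Basis (Fin m) (MvPolynomial σ K) (jacobianSyzygies f))

theorem syzygyMap_apply (ε : σ ≃ Fin N) (c : Fin m → MvPolynomial σ K) (l : Fin N) :
    syzygyMap ε b c l =
      ((∑ k, c k • b k : jacobianSyzygies f) : σ → MvPolynomial σ K) (ε.symm l) := by
  simp [syzygyMap, Fintype.linearCombination_apply]

theorem syzygyMap_single (ε : σ ≃ Fin N) (k : Fin m) (l : Fin N) :
    syzygyMap ε b (Pi.single k 1) l = (b k : σ → MvPolynomial σ K) (ε.symm l) := by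
  simp [syzygyMap, Fintype.linearCombination_apply_single]

theorem range_syzygyMap (ε : σ ≃ Fin N) :
    LinearMap.range (syzygyMap ε b) = LinearMap.ker (gradMap f ε) := by
  ext a
  rw [mem_ker_gradMap_iff]
  constructor
  · rintro ⟨c, rfl⟩
    convert (∑ k, c k • b k : jacobianSyzygies f).2 using 1
    funext v
    rw [syzygyMap_apply, Equiv.symm_apply_apply]
  · intro ha
    refine ⟨b.repr ⟨_, ha⟩, funext fun l => ?_⟩
    rw [syzygyMap_apply, b.sum_repr]
    exact congrArg a (ε.apply_symm_apply l)

theorem ker_syzygyMap (ε : σ ≃ Fin N) : LinearMap.ker (syzygyMap ε b) = ⊥ := by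
  rw [LinearMap.ker_eq_bot']
  intro c hc
  refine funext (Fintype.linearIndependent_iff.mp b.linearIndependent c (Subtype.ext ?_))
  funext v
  have := congrFun hc (ε v)
  rw [syzygyMap_apply, Equiv.symm_apply_apply] at this
  exact this

/-- The ranks of the modules in the resolution of the Milnor algebra of a free hypersurface with
`m` exponents in a projective space with `N` coordinates. -/
def milnorRank (N m : ℕ) : ℕ → ℕ
  | 0 => 1
  | 1 => N
  | 2 => m
  | _ => 0

/-- The degrees of the basis vectors in the resolution of the Milnor algebra of a free
hypersurface of degree `d` with exponents `e`. -/
def milnorShift (N d : ℕ) (e : Fin m → ℕ) : (i : ℕ) → Fin (milnorRank N m i) → ℤ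
  | 0 => fun _ => 0
  | 1 => fun _ => d - 1
  | 2 => fun k => d - 1 + e k
  | _ + 3 => fun _ => 0

/-- The differentials in the resolution of the Milnor algebra of a free hypersurface. -/
noncomputable def milnorDiff (ε : σ ≃ Fin N) : (i : ℕ) →
    (Fin (milnorRank N m (i + 1)) → MvPolynomial σ K) →ₗ[MvPolynomial σ K]
      (Fin (milnorRank N m i) → MvPolynomial σ K)
  | 0 => gradMap f ε
  | 1 => syzygyMap ε b
  | _ + 2 => 0

theorem syzygyMap_isHomogeneousOfDegree (ε : σ ≃ Fin N) (d : ℕ) {e : Fin m → ℕ}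
    (he : ∀ k v, ((b k : σ → MvPolynomial σ K) v).IsHomogeneous (e k)) (k : Fin m) (l : Fin N) :
    IsHomogeneousOfDegree (syzygyMap ε b (Pi.single k 1) l)
      ((d : ℤ) - 1 + e k - ((d : ℤ) - 1)) := by
  rw [syzygyMap_single]
  exact isHomogeneousOfDegree_of_isHomogeneous (he _ _) (by omega)

/-- The graded free resolution of the Milnor algebra of a free hypersurface. -/
noncomputable def milnorResolution (ε : σ ≃ Fin N) {d : ℕ} {e : Fin m → ℕ} (hd : 1 ≤ d)
    (hf : f.IsHomogeneous d)
    (he : ∀ k v, ((b k : σ → MvPolynomial σ K) v).IsHomogeneous (e k)) :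
    GradedFreeResolution (jacobianIdeal f) where
  rank := milnorRank N m
  shift := milnorShift N d e
  diff := milnorDiff b ε
  aug := (jacobianIdeal f).mkQ ∘ₗ
    LinearMap.proj (φ := fun _ : Fin 1 => MvPolynomial σ K) (0 : Fin 1)
  diff_homogeneous
    | 0 => gradMap_isHomogeneousOfDegree ε hd hf
    | 1 => syzygyMap_isHomogeneousOfDegree b ε d he
    | _ + 2 => fun k => k.elim0
  aug_homogeneous := exists_isHomogeneousOfDegree_zero _
  aug_surjective := (Submodule.mkQ_surjective _).comp
    (LinearMap.proj_surjective (φ := fun _ : Fin 1 => MvPolynomial σ K) 0)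
  exact_zero := range_gradMap ε
  exact_succ
    | 0 => range_syzygyMap b ε
    | 1 => LinearMap.range_zero.trans (ker_syzygyMap b ε).symm
    | _ + 2 =>
      Subsingleton.elim (α := Submodule (MvPolynomial σ K) (Fin 0 → MvPolynomial σ K)) _ _

theorem constantCoeff_syzygyMap (ε : σ ≃ Fin N) {e : Fin m → ℕ}
    (he : ∀ k v, ((b k : σ → MvPolynomial σ K) v).IsHomogeneous (e k)) (hpos : ∀ k, 1 ≤ e k)
    (k : Fin m) (l : Fin N) : constantCoeff (syzygyMap ε b (Pi.single k 1) l) = 0 := by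
  rw [syzygyMap_single]
  exact (he _ _).coeff_eq_zero (by have := hpos k; simp; omega)

theorem milnorResolution_isMinimal (ε : σ ≃ Fin N) {d : ℕ} {e : Fin m → ℕ} (hd : 1 ≤ d)
    (hf : f.IsHomogeneous d)
    (he : ∀ k v, ((b k : σ → MvPolynomial σ K) v).IsHomogeneous (e k)) (hd2 : 2 ≤ d)
    (hpos : ∀ k, 1 ≤ e k) : (milnorResolution b ε hd hf he).IsMinimal
  | 0 => constantCoeff_gradMap ε hd2 hf
  | 1 => constantCoeff_syzygyMap b ε he hpos
  | _ + 2 => fun k => k.elim0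

/-- The bound on the shifts of the resolution of the Milnor algebra. -/
theorem milnorShift_sub_le {d : ℕ} {e : Fin m → ℕ} (hd : 2 ≤ d) (hN : N = m + 1)
    (hsum : 1 + ∑ k, e k = d) (hpos : ∀ k, 1 ≤ e k) :
    ∀ (i : ℕ) (k : Fin (milnorRank N m i)),
      milnorShift N d e i k - (i : ℤ) ≤ 2 * (d : ℤ) - N - 2 := by
  have hm : m ≤ ∑ k, e k := by
    simpa using Finset.sum_le_sum (s := Finset.univ) fun k _ => hpos k
  rintro (_ | _ | _ | i) k
  · simp only [milnorShift]
    omega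
  · simp only [milnorShift]
    omega
  · change Fin m at k
    change (d : ℤ) - 1 + e k - ((2 : ℕ) : ℤ) ≤ _
    -- The other `m - 1` exponents are at least `1`, which leaves at most `d - 1 - (m - 1)` for `e
    -- k`.
    have h1 : m - 1 ≤ ∑ l ∈ Finset.univ.erase k, e l := by
      simpa using Finset.sum_le_sum (s := Finset.univ.erase k) fun l _ => hpos l
    have h2 := Finset.add_sum_erase Finset.univ e (Finset.mem_univ k)
    have h3 : 0 < m := k.pos
    omega
  · exact k.elim0

end FreeResolution

theorem regularity_le_of_isFreeHypersurface [Fintype σ] [CharZero K] {f : MvPolynomial σ K}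
    {d : ℕ} (hfree : IsFreeHypersurface f d) (hcone : IsNotCone f) :
    regularity (jacobianIdeal f) ≤
      (((2 * (d : ℤ) - Fintype.card σ - 2 : ℤ) : ℝ) : EReal) := by
  classical
  obtain ⟨hd, hf, hsq, m, e, b, he⟩ := hfree
  have hgrad : grad f ≠ 0 := by
    obtain ⟨v, hv⟩ : ∃ v, pderiv v f ≠ 0 :=
      exists_pderiv_ne_zero hsq.ne_zero fun hu => by
        obtain ⟨r, hr, rfl⟩ := isUnit_iff_eq_C_of_isReduced.mp hu
        have := hf.inj_right (isHomogeneous_C σ r) hsq.ne_zero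
        omega
    exact fun h => hv (congrFun h v)
  -- For `d = 1` some partial derivative is a nonzero constant, so the Milnor algebra is zero and
  -- has regularity `-∞`.
  rcases hd.eq_or_lt with rfl | hd2
  · have htop : jacobianIdeal f = ⊤ := by
      obtain ⟨v, hv⟩ := Function.ne_iff.mp hgrad
      refine Ideal.eq_top_of_isUnit_mem _ (Ideal.subset_span ⟨v, rfl⟩) ?_
      change pderiv v f ≠ 0 at hv
      change IsUnit (pderiv v f)
      have h0 := hf.pderiv (i := v)
      rw [totalDegree_eq_zero_iff_eq_C.mp ((totalDegree_zero_iff_isHomogeneous _).mpr h0)] at hv ⊢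
      exact (isUnit_iff_ne_zero.mpr fun h => hv (by rw [h, C_0])).map C
    rw [htop]
    exact regularity_top_le _
  have hcard := card_eq_of_basis hgrad b
  have hsum := sum_exponents hd hf hsq e b he hcard
  have hpos := exponent_pos hcone b he
  exact regularity_le (milnorResolution b (Fintype.equivFin σ) hd hf he)
    (milnorResolution_isMinimal b _ hd hf he hd2 hpos) (milnorShift_sub_le hd2 hcard hsum hpos)

section LowerBound

variable {I : Ideal (MvPolynomial σ K)}

theorem coeff_eq_zero_of_mem_span {T : Set (MvPolynomial σ K)} {D : ℕ}
    (hT : ∀ p ∈ T, p.IsHomogeneous D) {p : MvPolynomial σ K} (hp : p ∈ Ideal.span T)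
    {s : σ →₀ ℕ} (hs : s.degree < D) : coeff s p = 0 := by
  classical
  induction hp using Submodule.span_induction generalizing s with
  | mem p hp => exact (hT p hp).coeff_eq_zero hs.ne
  | zero => simp
  | add p q _ _ h1 h2 => rw [coeff_add, h1 hs, h2 hs, add_zero]
  | smul a p _ h =>
    rw [smul_eq_mul, coeff_mul]
    refine Finset.sum_eq_zero fun x hx => ?_
    rw [h, mul_zero]
    rw [← Finset.HasAntidiagonal.mem_antidiagonal.mp hx, map_add] at hs
    omega

theorem GradedFreeResolution.aug_apply (R : GradedFreeResolution I)
    {p : Fin (R.rank 0) → MvPolynomial σ K}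
    (hp : ∀ k, R.aug (Pi.single k 1) = Ideal.Quotient.mk I (p k))
    (x : Fin (R.rank 0) → MvPolynomial σ K) :
    R.aug x = Ideal.Quotient.mk I (∑ k, x k * p k) := by
  conv_lhs => rw [pi_eq_sum_univ' x, map_sum]
  simp only [map_smul, hp, map_sum, map_mul]
  rfl

theorem GradedFreeResolution.diff_apply (R : GradedFreeResolution I) (i : ℕ)
    (x : Fin (R.rank (i + 1)) → MvPolynomial σ K) (l : Fin (R.rank i)) :
    R.diff i x l = ∑ k, x k * R.diff i (Pi.single k 1) l := by
  conv_lhs => rw [pi_eq_sum_univ' x, map_sum]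
  simp

theorem GradedFreeResolution.IsMinimal.constantCoeff_diff {R : GradedFreeResolution I}
    (hR : R.IsMinimal) (i : ℕ) (x : Fin (R.rank (i + 1)) → MvPolynomial σ K)
    (l : Fin (R.rank i)) : constantCoeff (R.diff i x l) = 0 := by
  rw [R.diff_apply, map_sum]
  exact Finset.sum_eq_zero fun k _ => by rw [map_mul, hR i k l, mul_zero]

/-- In a minimal resolution of `S/I`, for `I ≠ 0` generated by forms of degree `D ≥ 1`, the first
syzygy module has a generator of degree at least `D`. -/
theorem GradedFreeResolution.IsMinimal.exists_le_shift_one {T : Set (MvPolynomial σ K)} {D : ℕ}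
    (hT : ∀ p ∈ T, p.IsHomogeneous D) (hD : 1 ≤ D) (hne : Ideal.span T ≠ ⊥)
    {R : GradedFreeResolution (Ideal.span T)} (hR : R.IsMinimal) :
    ∃ k, (D : ℤ) ≤ R.shift 1 k := by
  classical
  by_contra! hlt
  choose p hph hp using R.aug_homogeneous
  have hconst : ∀ q ∈ Ideal.span T, constantCoeff q = 0 := fun q hq =>
    coeff_eq_zero_of_mem_span hT hq (by rw [map_zero]; exact hD)
  have hker : ∀ x, R.aug x = 0 ↔ ∑ k, x k * p k ∈ Ideal.span T := fun x => by
    rw [R.aug_apply hp, Ideal.Quotient.eq_zero_iff_mem]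
  -- Lifting `1` through the augmentation, modulo an ideal without constant terms, gives some `p k`
  -- a nonzero constant term; homogeneity makes it constant.
  obtain ⟨k, c, hc, hk⟩ : ∃ k, ∃ c : K, c ≠ 0 ∧ p k = C c := by
    obtain ⟨x, hx⟩ := R.aug_surjective (Ideal.Quotient.mk _ 1)
    rw [R.aug_apply hp, Ideal.Quotient.mk_eq_mk_iff_sub_mem] at hx
    have h1 := hconst _ hx
    rw [map_sub, map_one, sub_eq_zero, map_sum] at h1
    obtain ⟨k, -, hk⟩ := Finset.exists_ne_zero_of_sum_ne_zero (h1.trans_ne one_ne_zero)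
    rw [map_mul] at hk
    have hc := right_ne_zero_of_mul hk
    refine ⟨k, _, hc, ?_⟩
    have hs : R.shift 0 k = 0 := by
      have := hph k 0 (mem_support_iff.mpr hc)
      simpa using this.symm
    ext s
    rw [coeff_C]
    split_ifs with h
    · rw [← h]; rfl
    · by_contra hne
      have h2 := hph k s (mem_support_iff.mpr hne)
      rw [hs, Nat.cast_eq_zero, Finsupp.degree_eq_zero_iff] at h2
      exact h h2.symm
  -- A second basis vector `l` would yield the kernel element `e_l - (p_l / c) e_k`, whose entry `1`
  -- contradicts minimality.
  have huniq : ∀ l, l = k := by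
    intro l
    by_contra hl
    have hmem : Pi.single l 1 - Pi.single k (p l * C c⁻¹) ∈ LinearMap.ker R.aug := by
      rw [LinearMap.mem_ker, hker]
      convert (Ideal.span T).zero_mem using 1
      simp only [Pi.sub_apply, sub_mul, Finset.sum_sub_distrib]
      simp only [Pi.single_apply, ite_mul, one_mul, zero_mul, Finset.sum_ite_eq',
        Finset.mem_univ, if_true]
      rw [hk, mul_assoc, ← C_mul, inv_mul_cancel₀ hc, C_1, mul_one, sub_self]
    rw [← R.exact_zero] at hmem
    obtain ⟨y, hy⟩ := hmem
    have h1 := hR.constantCoeff_diff 0 y l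
    rw [hy] at h1
    simp [hl] at h1
  have hsum : ∀ x : Fin (R.rank 0) → MvPolynomial σ K, ∑ l, x l * p l = x k * C c := by
    intro x
    rw [Finset.sum_eq_single k (fun l _ hl => absurd (huniq l) hl) (by simp), hk]
  have hmem : ∀ x, R.aug x = 0 ↔ x k ∈ Ideal.span T := fun x => by
    rw [hker, hsum, mul_comm]
    exact Ideal.unit_mul_mem_iff_mem _ ((isUnit_iff_ne_zero.mpr hc).map C)
  -- These entries lie in the ideal and have degree `shift 1 i < D`, where the ideal has no nonzero
  -- form.
  have hdiff : ∀ i, R.diff 0 (Pi.single i 1) k = 0 := by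
    intro i
    have h1 : R.diff 0 (Pi.single i 1) ∈ LinearMap.ker R.aug := by
      rw [← R.exact_zero]
      exact LinearMap.mem_range_self _ _
    rw [LinearMap.mem_ker, hmem] at h1
    by_contra hne
    obtain ⟨s, hs⟩ := support_nonempty.mpr hne
    have h2 := R.diff_homogeneous 0 i k s hs
    have h3 : R.shift 0 k = 0 := by
      have := hph k 0 (by rw [hk]; simpa using hc)
      simpa using this.symm
    have h4 : R.shift (0 + 1) i < D := hlt i
    rw [mem_support_iff] at hs
    refine hs (coeff_eq_zero_of_mem_span hT h1 ?_)
    rw [h3] at h2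
    omega
  refine hne ((Submodule.eq_bot_iff _).mpr fun g hg => ?_)
  have h1 : Pi.single k g ∈ LinearMap.ker R.aug := by
    rw [LinearMap.mem_ker, hmem, Pi.single_eq_same]
    exact hg
  rw [← R.exact_zero] at h1
  obtain ⟨y, hy⟩ := h1
  have h2 := congrFun hy k
  rw [R.diff_apply, Pi.single_eq_same] at h2
  rw [← h2]
  exact Finset.sum_eq_zero fun i _ => by rw [hdiff, mul_zero]

/-- As the regularity is an infimum, a lower bound has to hold in every minimal resolution; a
generator of `F₁` of degree at least `D` provides it. -/
theorem le_regularity_span {T : Set (MvPolynomial σ K)} {D : ℕ}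
    (hT : ∀ p ∈ T, p.IsHomogeneous D) (hD : 1 ≤ D) (hne : Ideal.span T ≠ ⊥) :
    ((((D : ℤ) - 1 : ℤ) : ℝ) : EReal) ≤ regularity (Ideal.span T) := by
  refine le_iInf₂ fun R hR => ?_
  obtain ⟨k, hk⟩ := hR.exists_le_shift_one hT hD hne
  refine le_iSup₂_of_le 1 k ?_
  have : (D : ℤ) - 1 ≤ R.shift 1 k - ((1 : ℕ) : ℤ) := by push_cast; omega
  exact_mod_cast this

end LowerBound

end Regularity

/-! ### Saito's criterion for linear vector fields. -/

section SaitoCriterion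

variable {σ K : Type*} [Fintype σ] [Field K]

/-- A linear relation between the partials is a constant syzygy, but combinations of basis elements
of positive degree have no constant term. -/
theorem isNotCone_of_basis {f : MvPolynomial σ K} {m : ℕ} {e : Fin m → ℕ}
    (b : Module.Basis (Fin m) (MvPolynomial σ K) (jacobianSyzygies f))
    (he : ∀ k v, ((b k : σ → MvPolynomial σ K) v).IsHomogeneous (e k)) (hpos : ∀ k, 1 ≤ e k) :
    IsNotCone f := by
  refine Fintype.linearIndependent_iff.mpr fun c hc v => ?_
  have hmem : (fun v => C (c v)) ∈ jacobianSyzygies f := by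
    rw [mem_jacobianSyzygies, ← hc]
    exact Finset.sum_congr rfl fun v _ => (smul_eq_C_mul _ _).symm
  have h1 := congrFun (congrArg Subtype.val (b.sum_repr ⟨_, hmem⟩)) v
  simp only [Submodule.coe_sum, Finset.sum_apply, Submodule.coe_smul, Pi.smul_apply,
    smul_eq_mul] at h1
  have h2 := congrArg constantCoeff h1
  rw [constantCoeff_C, map_sum] at h2
  rw [← h2]
  refine Finset.sum_eq_zero fun k _ => ?_
  have h3 : constantCoeff ((b k : σ → MvPolynomial σ K) v) = 0 :=
    (he k v).coeff_eq_zero (by have := hpos k; simp; omega)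
  rw [map_mul, h3, mul_zero]

variable [DecidableEq σ]

/-- By Cramer's rule the entry is the determinant of `A` with row `i` replaced by `θ`, and all rows
of that matrix are still logarithmic. -/
theorem dvd_adjugate_of_mem_jacobianSyzygies [CharZero K] {f : MvPolynomial σ K}
    (hsq : Squarefree f) {A : Matrix σ σ (MvPolynomial σ K)}
    (hA : ∀ i, f ∣ (A *ᵥ grad f) i) {θ : σ → MvPolynomial σ K} (hθ : θ ∈ jacobianSyzygies f)
    (i : σ) : f ∣ (θ ᵥ* A.adjugate) i := by
  have h1 : (θ ᵥ* A.adjugate) i = (A.updateRow i θ).det := by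
    rw [← cramer_transpose_apply, cramer_eq_adjugate_mulVec, ← adjugate_transpose,
      mulVec_transpose]
  rw [h1]
  refine dvd_det_of_dvd_mulVec_grad hsq fun k => ?_
  rw [mulVec]
  by_cases hk : k = i
  · subst hk
    simp only [updateRow_self]
    rw [mem_jacobianSyzygies.mp hθ]
    exact dvd_zero f
  · simp only [updateRow_ne hk]
    exact hA k

/-- Saito's criterion for linear vector fields: the rows of a nonsingular matrix of linear forms,
all but one of which kill `f` while the remaining one multiplies `f` by a nonzero constant, give a
basis of the Jacobian syzygies. -/
theorem exists_basis_of_linear_fields [CharZero K] {f : MvPolynomial σ K}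
    (hf : f.IsHomogeneous (Fintype.card σ)) (hsq : Squarefree f)
    {A : Matrix σ σ (MvPolynomial σ K)} (hlin : ∀ i j, (A i j).IsHomogeneous 1)
    (i₀ : σ) {r : K} (hr : r ≠ 0) (hA : A *ᵥ grad f = Pi.single i₀ (C r * f))
    (hdet : A.det ≠ 0) :
    ∃ (m : ℕ) (b : Module.Basis (Fin m) (MvPolynomial σ K) (jacobianSyzygies f)),
      ∀ k v, ((b k : σ → MvPolynomial σ K) v).IsHomogeneous 1 := by
  have hf0 : f ≠ 0 := hsq.ne_zero
  have hdvd : ∀ i, f ∣ (A *ᵥ grad f) i := by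
    intro i
    rw [hA]
    by_cases hi : i = i₀
    · subst hi
      simp
    · simp [hi]
  -- `f` divides the determinant, and both have degree `Fintype.card σ`.
  obtain ⟨c, hc, hdetc⟩ : ∃ c : K, c ≠ 0 ∧ A.det = C c * f := by
    obtain ⟨p, hp⟩ := dvd_det_of_dvd_mulVec_grad hsq hdvd
    have h1 : A.det.totalDegree = Fintype.card σ :=
      (det_isHomogeneous (r := fun _ => 1) hlin).totalDegree hdet |>.trans (by simp)
    have hp0 : p ≠ 0 := by
      rintro rfl
      exact hdet (by rw [hp, mul_zero])
    rw [hp, totalDegree_mul_of_isDomain hf0 hp0, hf.totalDegree hf0] at h1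
    have h2 := totalDegree_eq_zero_iff_eq_C.mp (show p.totalDegree = 0 by omega)
    refine ⟨coeff 0 p, fun h => hp0 (by rw [h2, h, C_0]), ?_⟩
    rw [← h2, hp, mul_comm]
  have hmem : ∀ i : {i // i ≠ i₀}, (fun v => A i v) ∈ jacobianSyzygies f := by
    intro i
    have := congrFun hA i
    rwa [Pi.single_eq_of_ne i.2] at this
  have hrows : LinearIndependent (MvPolynomial σ K) (fun i v => A i v) :=
    linearIndependent_rows_of_det_ne_zero hdet
  have hli : LinearIndependent (MvPolynomial σ K)
      (fun i : {i // i ≠ i₀} => (⟨_, hmem i⟩ : jacobianSyzygies f)) :=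
    LinearIndependent.of_comp (Submodule.subtype _)
      (hrows.comp (Subtype.val : {i // i ≠ i₀} → σ) Subtype.val_injective)
  have hspan : ⊤ ≤ Submodule.span (MvPolynomial σ K)
      (Set.range fun i : {i // i ≠ i₀} => (⟨_, hmem i⟩ : jacobianSyzygies f)) := by
    rintro ⟨θ, hθ⟩ -
    choose y hy using dvd_adjugate_of_mem_jacobianSyzygies hsq hdvd hθ
    -- Multiply `θ * adj A = f y` by `A` and cancel `f`.
    have h1 : (C c : MvPolynomial σ K) • θ = y ᵥ* A := by
      have h2 : (θ ᵥ* A.adjugate) ᵥ* A = A.det • θ := by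
        rw [vecMul_vecMul, adjugate_mul, vecMul_smul, vecMul_one]
      rw [show θ ᵥ* A.adjugate = f • y from funext hy, smul_vecMul, hdetc, mul_comm,
        mul_smul] at h2
      funext v
      exact mul_left_cancel₀ hf0 (congrFun h2 v).symm
    -- Pairing with the gradient kills `θ` and every row of `A` except row `i₀`.
    have h3 : y i₀ = 0 := by
      have h4 : (y ᵥ* A) ⬝ᵥ grad f = 0 := by
        rw [← h1, smul_dotProduct, mem_jacobianSyzygies.mp hθ, smul_zero]
      rw [← dotProduct_mulVec, hA, dotProduct_single] at h4
      simpa [hr, hf0] using h4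
    have h5 : θ = ∑ i : {i // i ≠ i₀}, (C c⁻¹ * y i) • fun v => A i v := by
      have h6 : θ = (C c⁻¹ : MvPolynomial σ K) • (y ᵥ* A) := by
        rw [← h1, smul_smul, ← C_mul, inv_mul_cancel₀ hc, C_1, one_smul]
      funext v
      rw [h6, Finset.sum_apply, Pi.smul_apply, vecMul, dotProduct, Finset.smul_sum,
        ← Finset.add_sum_erase _ _ (Finset.mem_univ i₀), h3, zero_mul, smul_zero, zero_add,
        Finset.sum_subtype (p := fun i => i ≠ i₀) _ (by simp)]
      exact Finset.sum_congr rfl fun i _ => by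
        simp only [Pi.smul_apply, smul_eq_mul, mul_assoc]
    have h7 : (⟨θ, hθ⟩ : jacobianSyzygies f) =
        ∑ i : {i // i ≠ i₀}, (C c⁻¹ * y i) • (⟨_, hmem i⟩ : jacobianSyzygies f) := by
      refine Subtype.ext (h5.trans ?_)
      simp only [Submodule.coe_sum, Submodule.coe_smul]
    rw [h7]
    exact Submodule.sum_mem _ fun i _ =>
      Submodule.smul_mem _ _ (Submodule.subset_span ⟨i, rfl⟩)
  refine ⟨_, (Module.Basis.mk hli hspan).reindex (Fintype.equivFin _), fun k v => ?_⟩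
  rw [Module.Basis.reindex_apply, Module.Basis.mk_apply]
  exact hlin _ _

theorem isFreeHypersurface_of_linear_fields [CharZero K] [Nonempty σ] {f : MvPolynomial σ K}
    (hf : f.IsHomogeneous (Fintype.card σ)) (hsq : Squarefree f)
    {A : Matrix σ σ (MvPolynomial σ K)} (hlin : ∀ i j, (A i j).IsHomogeneous 1)
    (i₀ : σ) {r : K} (hr : r ≠ 0) (hA : A *ᵥ grad f = Pi.single i₀ (C r * f))
    (hdet : A.det ≠ 0) : IsFreeHypersurface f (Fintype.card σ) ∧ IsNotCone f := by
  obtain ⟨m, b, hb⟩ := exists_basis_of_linear_fields hf hsq hlin i₀ hr hA hdet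
  exact ⟨⟨Fintype.card_pos, hf, hsq, m, fun _ => 1, b, hb⟩,
    isNotCone_of_basis b hb fun _ => le_rfl⟩

/-- The variant of `isFreeHypersurface_of_linear_fields` for vector fields that multiply `f` by
arbitrary constants, with nonsingularity tested at the point `x`. -/
theorem isFreeHypersurface_of_logarithmic_fields [CharZero K] {f : MvPolynomial σ K}
    (hf : f.IsHomogeneous (Fintype.card σ)) (hsq : Squarefree f)
    {B : Matrix σ σ (MvPolynomial σ K)} (hlin : ∀ i j, (B i j).IsHomogeneous 1)
    (r : σ → K) (hB : ∀ i, (B *ᵥ grad f) i = C (r i) * f) (i₀ : σ) (hr : r i₀ ≠ 0)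
    (x : σ → K) (hx : ∀ c : σ → K, (∀ v, ∑ i, c i * eval x (B i v) = 0) → c = 0) :
    IsFreeHypersurface f (Fintype.card σ) ∧ IsNotCone f := by
  have : Nonempty σ := ⟨i₀⟩
  -- Subtracting multiples of row `i₀` makes the other rows kill `f` without changing the
  -- determinant.
  let q : σ → K := fun i => if i = i₀ then 0 else - (r i / r i₀)
  let A : Matrix σ σ (MvPolynomial σ K) := Matrix.of fun i j => B i j + C (q i) * B i₀ j
  have hdet : A.det = B.det :=
    det_eq_of_forall_row_eq_smul_add_const (fun i => C (q i)) i₀ (by simp [q]) fun i j => rfl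
  refine isFreeHypersurface_of_linear_fields (A := A) hf hsq
    (fun i j => (hlin i j).add ((hlin i₀ j).C_mul _)) i₀ hr ?_ ?_
  · funext i
    have h1 : (A *ᵥ grad f) i = (B *ᵥ grad f) i + C (q i) * (B *ᵥ grad f) i₀ := by
      simp only [A, mulVec, dotProduct, of_apply, add_mul, Finset.sum_add_distrib,
        Finset.mul_sum, mul_assoc]
    rw [h1, hB, hB, ← mul_assoc, ← C_mul, ← add_mul, ← C_add]
    by_cases hi : i = i₀
    · subst hi
      simp [q]
    · simp [q, hi, hr]
  · rw [hdet]
    intro h0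
    have h1 : ((eval x).mapMatrix B).det = 0 := by rw [← RingHom.map_det, h0, map_zero]
    obtain ⟨c, hc, hc0⟩ := exists_vecMul_eq_zero_iff.mpr h1
    exact hc (hx c fun v => congrFun hc0 v)

end SaitoCriterion

/-! ### Criteria by partial derivatives in characteristic zero. -/

section Coprimality

variable {σ K : Type*} [Field K] [CharZero K]

theorem degreeOf_eq_zero_of_pderiv_eq_zero {p : MvPolynomial σ K} {v : σ}
    (h : pderiv v p = 0) : degreeOf v p = 0 := by
  rw [← Nat.le_zero, degreeOf_le_iff]
  intro m hm
  by_contra hv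
  have h1 := coeff_pderiv (i := v) p (m - Finsupp.single v 1)
  rw [h, coeff_zero, tsub_add_cancel_of_le (by
    classical rw [Finsupp.single_le_iff]; omega)] at h1
  have h2 : ((m - Finsupp.single v 1 : σ →₀ ℕ) v : K) + 1 ≠ 0 := Nat.cast_add_one_ne_zero _
  exact mem_support_iff.mp hm ((mul_eq_zero.mp h1.symm).resolve_right h2)

/-- Degrees in one variable are additive, so a divisor of a polynomial free of that variable is free
of it too. -/
theorem pderiv_eq_zero_of_dvd {g h : MvPolynomial σ K} {v : σ} (hgh : g ∣ h) (h0 : h ≠ 0)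
    (hv : pderiv v h = 0) : pderiv v g = 0 := by
  obtain ⟨k, rfl⟩ := hgh
  have h1 := degreeOf_eq_zero_of_pderiv_eq_zero hv
  rw [degreeOf_mul_eq (left_ne_zero_of_mul h0) (right_ne_zero_of_mul h0)] at h1
  by_contra h2
  have := degreeOf_pderiv_lt h2
  omega

theorem isUnit_of_forall_pderiv_eq_zero {g : MvPolynomial σ K} (h0 : g ≠ 0)
    (h : ∀ v, pderiv v g = 0) : IsUnit g := by
  by_contra hu
  obtain ⟨v, hv⟩ := exists_pderiv_ne_zero h0 hu
  exact hv (h v)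

/-- A polynomial of degree at most one in each variable is squarefree. -/
theorem squarefree_of_pderiv_pderiv_eq_zero {h : MvPolynomial σ K} (h0 : h ≠ 0)
    (hh : ∀ v, pderiv v (pderiv v h) = 0) : Squarefree h := by
  intro g hg
  refine isUnit_of_forall_pderiv_eq_zero (fun hg0 => h0 ?_) fun v => ?_
  · rwa [hg0, zero_mul, zero_dvd_iff] at hg
  · by_cases hv : pderiv v h = 0
    · exact pderiv_eq_zero_of_dvd (dvd_of_mul_left_dvd hg) h0 hv
    -- If `g²` divides `h`, then `g` divides `pderiv v h`, which does not involve `v`.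
    · refine pderiv_eq_zero_of_dvd ?_ hv (hh v)
      obtain ⟨k, rfl⟩ := hg
      exact ⟨2 * pderiv v g * k + g * pderiv v k, by simp only [pderiv_mul]; ring⟩

end Coprimality

/-! ### The maximal minors and their products. -/

section ColumnMinor

variable {K : Type*} [Field K]

/-- The minor of the generic `3 × 5` matrix on the columns `c`. -/
noncomputable def columnMinor (K : Type*) [Field K] (c : Fin 3 → Fin 5) :
    MvPolynomial (Fin 3 × Fin 5) K :=
  ((mvPolynomialX (Fin 3) (Fin 5) K).submatrix id c).det

theorem columnMinor_eq (c : Fin 3 → Fin 5) : columnMinor K c =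
    X (0, c 0) * X (1, c 1) * X (2, c 2) - X (0, c 0) * X (1, c 2) * X (2, c 1) -
    X (0, c 1) * X (1, c 0) * X (2, c 2) + X (0, c 1) * X (1, c 2) * X (2, c 0) +
    X (0, c 2) * X (1, c 0) * X (2, c 1) - X (0, c 2) * X (1, c 1) * X (2, c 0) := by
  simp [columnMinor, det_fin_three]

theorem columnMinor_isHomogeneous (c : Fin 3 → Fin 5) : (columnMinor K c).IsHomogeneous 3 :=
  det_isHomogeneous (r := fun _ => 1) fun i j => isHomogeneous_X K (i, c j)

theorem pderiv_X_prod (a k : Fin 3) (t u : Fin 5) :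
    pderiv (a, t) (X (k, u) : MvPolynomial (Fin 3 × Fin 5) K) =
      if k = a then C (if u = t then 1 else 0) else 0 := by
  by_cases h1 : k = a <;> by_cases h2 : u = t <;> simp [h1, h2, pderiv_X]

/-- Each term of the determinant contains exactly one variable of row `a`. -/
theorem pderiv_pderiv_columnMinor (c : Fin 3 → Fin 5) (a : Fin 3) (s t : Fin 5) :
    pderiv (a, s) (pderiv (a, t) (columnMinor K c)) = 0 := by
  rw [columnMinor_eq]
  simp only [map_sub, map_add, pderiv_mul, pderiv_X_prod]
  fin_cases a <;> simp [apply_ite]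

theorem pderiv_columnMinor_eq_zero {c : Fin 3 → Fin 5} (a : Fin 3) {t : Fin 5}
    (ht : ∀ l, c l ≠ t) : pderiv (a, t) (columnMinor K c) = 0 := by
  rw [columnMinor_eq]
  simp only [map_sub, map_add, pderiv_mul, pderiv_X_prod, ht]
  simp

theorem pderiv_columnMinor_ne_zero {c : Fin 3 → Fin 5} (hc : Function.Injective c)
    (a l : Fin 3) : pderiv (a, c l) (columnMinor K c) ≠ 0 := by
  intro h
  -- The derivative is a signed cofactor. At this point the chosen columns form a permutation matrix
  -- with a `1` at the deleted entry, so the cofactor is `±1`.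
  have h1 := congrArg
    (eval fun v : Fin 3 × Fin 5 => if v.2 = c (Equiv.swap l a v.1) then (1 : K) else 0) h
  rw [columnMinor_eq] at h1
  simp only [map_sub, map_add, pderiv_mul, pderiv_X_prod] at h1
  revert h1
  fin_cases a <;> fin_cases l <;>
    simp [hc.eq_iff, Equiv.swap_apply_def]

theorem columnMinor_ne_zero {c : Fin 3 → Fin 5} (hc : Function.Injective c) :
    columnMinor K c ≠ 0 := fun h =>
  pderiv_columnMinor_ne_zero (K := K) hc 0 0 (by rw [h, map_zero])

/-- The product of the four minors on the first four columns and the minor on the columns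
`p`, `q` and the last one. -/
noncomputable def fiveMinors (K : Type*) [Field K] (p q : Fin 5) :
    MvPolynomial (Fin 3 × Fin 5) K :=
  columnMinor K ![0, 1, 2] * columnMinor K ![0, 1, 3] * columnMinor K ![0, 2, 3] *
    columnMinor K ![1, 2, 3] * columnMinor K ![p, q, 4]

theorem fiveMinors_isHomogeneous (p q : Fin 5) : (fiveMinors K p q).IsHomogeneous 15 :=
  ((((columnMinor_isHomogeneous _).mul (columnMinor_isHomogeneous _)).mul
    (columnMinor_isHomogeneous _)).mul (columnMinor_isHomogeneous _)).mul
    (columnMinor_isHomogeneous _)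

variable [CharZero K]

theorem columnMinor_squarefree {c : Fin 3 → Fin 5} (hc : Function.Injective c) :
    Squarefree (columnMinor K c) :=
  squarefree_of_pderiv_pderiv_eq_zero (columnMinor_ne_zero hc) fun v =>
    pderiv_pderiv_columnMinor c v.1 v.2 v.2

/-- A common divisor `g` is free of column `c l`, because the second minor is. Hence it divides each
cofactor of the first minor along that column, and the cofactor for row `v.1` is free of that row.
So no variable occurs in `g`. -/
theorem isRelPrime_columnMinor {c c' : Fin 3 → Fin 5} (hc : Function.Injective c)
    (hc' : Function.Injective c') (l : Fin 3) (hl : ∀ k, c' k ≠ c l) :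
    IsRelPrime (columnMinor K c) (columnMinor K c') := by
  intro g hg hg'
  refine isUnit_of_forall_pderiv_eq_zero (ne_zero_of_dvd_ne_zero (columnMinor_ne_zero hc) hg)
    fun v => ?_
  have h1 : pderiv (v.1, c l) g = 0 := pderiv_eq_zero_of_dvd hg' (columnMinor_ne_zero hc')
    (pderiv_columnMinor_eq_zero v.1 hl)
  refine pderiv_eq_zero_of_dvd ?_ (pderiv_columnMinor_ne_zero (K := K) hc v.1 l)
    (pderiv_pderiv_columnMinor c v.1 v.2 (c l))
  obtain ⟨k, hk⟩ := hg
  exact ⟨pderiv (v.1, c l) k, by rw [hk, pderiv_mul, h1, zero_mul, zero_add]⟩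

theorem fiveMinors_squarefree {p q : Fin 5} (hpq : p ≠ q) (hp : p ≠ 4) (hq : q ≠ 4) :
    Squarefree (fiveMinors K p q) := by
  have h1 : Function.Injective ![(0 : Fin 5), 1, 2] := by decide
  have h2 : Function.Injective ![(0 : Fin 5), 1, 3] := by decide
  have h3 : Function.Injective ![(0 : Fin 5), 2, 3] := by decide
  have h4 : Function.Injective ![(1 : Fin 5), 2, 3] := by decide
  have h5 : Function.Injective ![p, q, 4] := by
    revert hpq hp hq
    revert p q
    decide
  simp only [fiveMinors, squarefree_mul_iff, IsRelPrime.mul_left_iff]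
  exact ⟨⟨⟨⟨isRelPrime_columnMinor h5 h1 2 (show ∀ k, _ ≠ (4 : Fin 5) by decide) |>.symm,
    isRelPrime_columnMinor h5 h2 2 (show ∀ k, _ ≠ (4 : Fin 5) by decide) |>.symm⟩,
    isRelPrime_columnMinor h5 h3 2 (show ∀ k, _ ≠ (4 : Fin 5) by decide) |>.symm⟩,
    isRelPrime_columnMinor h5 h4 2 (show ∀ k, _ ≠ (4 : Fin 5) by decide) |>.symm⟩,
    ⟨⟨⟨isRelPrime_columnMinor h1 h4 0 (by decide), isRelPrime_columnMinor h2 h4 0 (by decide)⟩,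
      isRelPrime_columnMinor h3 h4 0 (by decide)⟩,
    ⟨⟨isRelPrime_columnMinor h1 h3 1 (by decide), isRelPrime_columnMinor h2 h3 1 (by decide)⟩,
    ⟨isRelPrime_columnMinor h1 h2 2 (by decide), columnMinor_squarefree h1,
      columnMinor_squarefree h2⟩, columnMinor_squarefree h3⟩, columnMinor_squarefree h4⟩,
    columnMinor_squarefree h5⟩

end ColumnMinor

/-! ### The fifteen linear logarithmic fields. -/

section VectorFields

variable {K : Type*} [Field K]

/-- Viewing a field as a derivation lets the Leibniz rule handle products of minors. -/
theorem dotProduct_grad_eq_mkDerivation {σ : Type*} [Fintype σ] (θ : σ → MvPolynomial σ K)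
    (f : MvPolynomial σ K) : θ ⬝ᵥ grad f = mkDerivation K θ f := by
  classical
  have hsum : ∀ g, (∑ v, θ v • pderiv v : Derivation K (MvPolynomial σ K) (MvPolynomial σ K)) g =
      ∑ v, θ v * pderiv v g := fun g => by
    rw [← Derivation.coeFnAddMonoidHom_apply, map_sum, Finset.sum_apply]
    rfl
  have h : (∑ v, θ v • pderiv v : Derivation K (MvPolynomial σ K) (MvPolynomial σ K)) =
      mkDerivation K θ := by
    refine derivation_ext fun v => ?_
    rw [hsum, mkDerivation_X]
    simp only [pderiv_X, Pi.single_apply]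
    simp
  rw [← h, hsum]
  rfl

/-- The linear vector field that adds row `j` of the generic matrix to row `i`. -/
noncomputable def rowField (K : Type*) [Field K] (i j : Fin 3) :
    Fin 3 × Fin 5 → MvPolynomial (Fin 3 × Fin 5) K :=
  fun v => if v.1 = i then X (j, v.2) else 0

/-- The linear vector field that adds column `p` of the generic matrix to column `t`. -/
noncomputable def columnField (K : Type*) [Field K] (p t : Fin 5) :
    Fin 3 × Fin 5 → MvPolynomial (Fin 3 × Fin 5) K :=
  fun v => if v.2 = t then X (v.1, p) else 0

theorem rowField_isHomogeneous (i j : Fin 3) (v : Fin 3 × Fin 5) :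
    (rowField K i j v).IsHomogeneous 1 := by
  rw [rowField]
  split_ifs
  · exact isHomogeneous_X _ _
  · exact isHomogeneous_zero _ _ _

theorem columnField_isHomogeneous (p t : Fin 5) (v : Fin 3 × Fin 5) :
    (columnField K p t v).IsHomogeneous 1 := by
  rw [columnField]
  split_ifs
  · exact isHomogeneous_X _ _
  · exact isHomogeneous_zero _ _ _

theorem rowField_columnMinor (i j : Fin 3) (c : Fin 3 → Fin 5) :
    mkDerivation K (rowField K i j) (columnMinor K c) =
      C (if i = j then 1 else 0) * columnMinor K c := by
  rw [columnMinor_eq]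
  simp only [map_add, map_sub, Derivation.leibniz, mkDerivation_X, rowField, smul_eq_mul]
  fin_cases i <;> fin_cases j <;> simp <;> ring

theorem columnField_self_columnMinor (t : Fin 5) (c : Fin 3 → Fin 5) :
    mkDerivation K (columnField K t t) (columnMinor K c) =
      C (∑ l, if c l = t then 1 else 0) * columnMinor K c := by
  have h : ∀ a u, columnField K t t (a, u) = C (if u = t then 1 else 0) * X (a, u) := by
    intro a u
    rw [columnField]
    by_cases hu : u = t
    · simp [hu]
    · simp [hu]
  rw [columnMinor_eq]
  simp only [map_add, map_sub, Derivation.leibniz, mkDerivation_X, h, smul_eq_mul,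
    Fin.sum_univ_three]
  ring

theorem columnField_columnMinor_of_ne {t : Fin 5} (p : Fin 5) {c : Fin 3 → Fin 5}
    (hc : ∀ l, c l ≠ t) : mkDerivation K (columnField K p t) (columnMinor K c) = 0 := by
  rw [columnMinor_eq]
  simp only [map_add, map_sub, Derivation.leibniz, mkDerivation_X, columnField, hc]
  simp

/-- The derivative is the minor with column `t` replaced by column `p`, which then occurs twice. -/
theorem columnField_columnMinor_of_mem {t p : Fin 5} {c : Fin 3 → Fin 5} (h0 : c 0 ≠ t)
    (h1 : c 1 ≠ t) (h2 : c 2 = t) (hp : p = c 0 ∨ p = c 1) :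
    mkDerivation K (columnField K p t) (columnMinor K c) = 0 := by
  rw [columnMinor_eq]
  simp only [map_add, map_sub, Derivation.leibniz, mkDerivation_X, columnField, h0, h1, h2,
    if_true, if_false, smul_eq_mul]
  rcases hp with rfl | rfl <;> ring

theorem mkDerivation_fiveMinors {θ : Fin 3 × Fin 5 → MvPolynomial (Fin 3 × Fin 5) K}
    {p q : Fin 5} {w : (Fin 3 → Fin 5) → K}
    (h : ∀ c ∈ ({![0, 1, 2], ![0, 1, 3], ![0, 2, 3], ![1, 2, 3], ![p, q, 4]} :
      Set (Fin 3 → Fin 5)), mkDerivation K θ (columnMinor K c) = C (w c) * columnMinor K c) :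
    mkDerivation K θ (fiveMinors K p q) =
      C (w ![0, 1, 2] + w ![0, 1, 3] + w ![0, 2, 3] + w ![1, 2, 3] + w ![p, q, 4]) *
        fiveMinors K p q := by
  simp only [fiveMinors, Derivation.leibniz, smul_eq_mul, C_add]
  rw [h ![0, 1, 2] (by simp), h ![0, 1, 3] (by simp), h ![0, 2, 3] (by simp),
    h ![1, 2, 3] (by simp), h ![p, q, 4] (by simp)]
  ring

/-- Fifteen linear vector fields that are logarithmic along the hypersurface `fiveMinors K p q`:
the row operations, the scalings of the first four columns, and the additions of the columns `p`
and `q` to the last column. -/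
noncomputable def logFields (K : Type*) [Field K] (p q : Fin 5) :
    Matrix (Fin 3 × Fin 5) (Fin 3 × Fin 5) (MvPolynomial (Fin 3 × Fin 5) K) :=
  Matrix.of fun i => ![rowField K i.1 0, rowField K i.1 1, rowField K i.1 2,
    columnField K i.1.castSucc.castSucc i.1.castSucc.castSucc,
    ![columnField K 3 3, columnField K p 4, columnField K q 4] i.1] i.2

theorem logFields_isHomogeneous (p q : Fin 5) (i j : Fin 3 × Fin 5) :
    (logFields K p q i j).IsHomogeneous 1 := by
  obtain ⟨a, t⟩ := i
  simp only [logFields, of_apply]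
  fin_cases t
  · exact rowField_isHomogeneous _ _ _
  · exact rowField_isHomogeneous _ _ _
  · exact rowField_isHomogeneous _ _ _
  · exact columnField_isHomogeneous _ _ _
  · fin_cases a <;> exact columnField_isHomogeneous _ _ _

theorem columnField_four_fiveMinors {p q s : Fin 5} (hp : p ≠ 4) (hq : q ≠ 4)
    (hs : s = p ∨ s = q) : mkDerivation K (columnField K s 4) (fiveMinors K p q) = 0 := by
  rw [mkDerivation_fiveMinors (w := fun _ => 0)]
  · simp
  · intro c hc
    rw [C_0, zero_mul]
    rcases hc with rfl | rfl | rfl | rfl | rfl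
    · exact columnField_columnMinor_of_ne _ (by decide)
    · exact columnField_columnMinor_of_ne _ (by decide)
    · exact columnField_columnMinor_of_ne _ (by decide)
    · exact columnField_columnMinor_of_ne _ (by decide)
    · exact columnField_columnMinor_of_mem hp hq rfl hs

theorem exists_logFields_mulVec_grad {p q : Fin 5} (hp : p ≠ 4) (hq : q ≠ 4)
    (i : Fin 3 × Fin 5) :
    ∃ r : K, (logFields K p q *ᵥ grad (fiveMinors K p q)) i = C r * fiveMinors K p q := by
  have key : ∀ θ : Fin 3 × Fin 5 → MvPolynomial (Fin 3 × Fin 5) K,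
      (logFields K p q) i = θ → (∃ r : K, mkDerivation K θ (fiveMinors K p q) =
        C r * fiveMinors K p q) →
      ∃ r : K, (logFields K p q *ᵥ grad (fiveMinors K p q)) i = C r * fiveMinors K p q := by
    rintro θ rfl h
    rwa [mulVec, dotProduct_grad_eq_mkDerivation]
  have hrow : ∀ a b, ∃ r : K, mkDerivation K (rowField K a b) (fiveMinors K p q) =
      C r * fiveMinors K p q := fun a b =>
    ⟨_, mkDerivation_fiveMinors fun c _ => rowField_columnMinor a b c⟩
  have hcol : ∀ t, ∃ r : K, mkDerivation K (columnField K t t) (fiveMinors K p q) =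
      C r * fiveMinors K p q := fun t =>
    ⟨_, mkDerivation_fiveMinors fun c _ => columnField_self_columnMinor t c⟩
  obtain ⟨a, t⟩ := i
  fin_cases t
  · exact key _ rfl (hrow a 0)
  · exact key _ rfl (hrow a 1)
  · exact key _ rfl (hrow a 2)
  · exact key _ rfl (hcol _)
  · fin_cases a
    · exact key _ rfl (hcol 3)
    · exact key (columnField K p 4) rfl
        ⟨0, by rw [columnField_four_fiveMinors hp hq (.inl rfl), C_0, zero_mul]⟩
    · exact key (columnField K q 4) rfl
        ⟨0, by rw [columnField_four_fiveMinors hp hq (.inr rfl), C_0, zero_mul]⟩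

/-- Scaling the first row scales each of the five factors once; this field plays the role of the
Euler field in Saito's criterion. -/
theorem logFields_mulVec_grad_zero (p q : Fin 5) :
    (logFields K p q *ᵥ grad (fiveMinors K p q)) (0, 0) = C 5 * fiveMinors K p q := by
  change rowField K 0 0 ⬝ᵥ _ = _
  rw [dotProduct_grad_eq_mkDerivation,
    mkDerivation_fiveMinors fun c _ => rowField_columnMinor 0 0 c]
  norm_num

/-- A matrix in the open orbit of the group generated by the flows of `logFields`. -/
def generalPoint (K : Type*) [Field K] : Fin 3 × Fin 5 → K :=
  fun v => (!![1, 0, 0, 1, 1; 0, 1, 0, 1, 2; 0, 0, 1, 1, 3] : Matrix (Fin 3) (Fin 5) K) v.1 v.2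

theorem eval_rowField (x : Fin 3 × Fin 5 → K) (i j a : Fin 3) (t : Fin 5) :
    eval x (rowField K i j (a, t)) = if a = i then x (j, t) else 0 := by
  rw [rowField]
  split_ifs <;> simp

theorem eval_columnField (x : Fin 3 × Fin 5 → K) (p s : Fin 5) (a : Fin 3) (t : Fin 5) :
    eval x (columnField K p s (a, t)) = if t = s then x (a, p) else 0 := by
  rw [columnField]
  split_ifs <;> simp

theorem sum_eval_logFields (p q : Fin 5) (x c : Fin 3 × Fin 5 → K) (a : Fin 3) (t : Fin 5) :
    ∑ i, c i * eval x (logFields K p q i (a, t)) =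
      c (a, 0) * x (0, t) + c (a, 1) * x (1, t) + c (a, 2) * x (2, t) +
      ![c (0, 3), c (1, 3), c (2, 3), c (0, 4), 0] t * x (a, t) +
      if t = 4 then c (1, 4) * x (a, p) + c (2, 4) * x (a, q) else 0 := by
  have h : ∀ i j, logFields K p q (i, j) (a, t) =
      ![rowField K i 0, rowField K i 1, rowField K i 2,
        columnField K i.castSucc.castSucc i.castSucc.castSucc,
        ![columnField K 3 3, columnField K p 4, columnField K q 4] i] j (a, t) := fun _ _ => rfl
  simp only [Fintype.sum_prod_type, Fin.sum_univ_three, Fin.sum_univ_five, h]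
  simp [eval_rowField, eval_columnField]
  fin_cases a <;> fin_cases t <;> simp <;> ring

/-- Columns `0`, `1`, `2` force the row operation to be diagonal and opposite to the column
scalings, and column `3` makes it a scalar. In column `4` this becomes a relation between `(1, 2,
3)` and columns `p`, `q`, which are independent for every choice of `p < q < 4`. -/
theorem eq_zero_of_logFields_generalPoint [CharZero K] {p q : Fin 5} (hpq : p < q) (hq : q < 4)
    (c : Fin 3 × Fin 5 → K)
    (hc : ∀ v, ∑ i, c i * eval (generalPoint K) (logFields K p q i v) = 0) : c = 0 := by
  have h := fun a t => (sum_eval_logFields p q _ c a t).symm.trans (hc (a, t))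
  have h00 := h 0 0
  have h01 := h 0 1
  have h02 := h 0 2
  have h03 := h 0 3
  have h04 := h 0 4
  have h10 := h 1 0
  have h11 := h 1 1
  have h12 := h 1 2
  have h13 := h 1 3
  have h14 := h 1 4
  have h20 := h 2 0
  have h21 := h 2 1
  have h22 := h 2 2
  have h23 := h 2 3
  have h24 := h 2 4
  clear h hc
  simp [generalPoint] at h00 h01 h02 h03 h10 h11 h12 h13 h20 h21 h22 h23
  have h3 : c (0, 4) = 0 ∧ c (1, 4) = 0 ∧ c (2, 4) = 0 := by
    fin_cases p <;> fin_cases q <;> first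
      | exact absurd hpq (by decide)
      | exact absurd hq (by decide)
      | (simp [generalPoint] at h04 h14 h24; grind)
  obtain ⟨h4, h5, h6⟩ := h3
  have h7 : c (0, 0) = 0 := by grind
  funext ⟨a, t⟩
  fin_cases a <;> fin_cases t <;> simp <;> grind

end VectorFields

/-! ### Application to the arrangements `F_j`. -/

variable {K : Type*} [Field K]

theorem exists_arrangement_eq_fiveMinors {j : ℕ} (hj : j ∈ Finset.Icc 5 10) :
    ∃ p q : Fin 5, p < q ∧ q < 4 ∧ arrangement K j = fiveMinors K p q := by
  obtain ⟨h5, h10⟩ := Finset.mem_Icc.mp hj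
  interval_cases j
  · exact ⟨0, 1, by decide, by decide, rfl⟩
  · exact ⟨0, 2, by decide, by decide, rfl⟩
  · exact ⟨1, 2, by decide, by decide, rfl⟩
  · exact ⟨0, 3, by decide, by decide, rfl⟩
  · exact ⟨1, 3, by decide, by decide, rfl⟩
  · exact ⟨2, 3, by decide, by decide, rfl⟩

theorem fiveMinors_isFreeHypersurface [CharZero K] {p q : Fin 5} (hpq : p < q) (hq : q < 4) :
    IsFreeHypersurface (fiveMinors K p q) 15 ∧ IsNotCone (fiveMinors K p q) := by
  have hp4 : p ≠ 4 := (hpq.trans hq).ne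
  choose r hr using exists_logFields_mulVec_grad (K := K) hp4 hq.ne
  have hsq := fiveMinors_squarefree (K := K) hpq.ne hp4 hq.ne
  have hcard : Fintype.card (Fin 3 × Fin 5) = 15 := by simp
  have hr0 : r (0, 0) ≠ 0 := by
    intro h0
    have h1 := (hr (0, 0)).symm.trans (logFields_mulVec_grad_zero p q)
    rw [h0] at h1
    have h2 := C_injective _ _ (mul_right_cancel₀ hsq.ne_zero h1)
    exact OfNat.ofNat_ne_zero 5 h2.symm
  have := isFreeHypersurface_of_logarithmic_fields (hcard ▸ fiveMinors_isHomogeneous p q) hsq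
    (logFields_isHomogeneous p q) r hr (0, 0) hr0 (generalPoint K)
    (eq_zero_of_logFields_generalPoint hpq hq)
  rwa [hcard] at this

theorem le_regularity_jacobianIdeal {σ : Type*} [Nonempty σ] {f : MvPolynomial σ K} {d : ℕ}
    (hf : f.IsHomogeneous d) (hd : 2 ≤ d) (hcone : IsNotCone f) :
    ((((d : ℤ) - 2 : ℤ) : ℝ) : EReal) ≤ regularity (jacobianIdeal f) := by
  have h := le_regularity_span (T := Set.range fun v : σ => pderiv v f) (D := d - 1)
    (by rintro _ ⟨v, rfl⟩; exact hf.pderiv) (by omega) (by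
      obtain ⟨v⟩ := ‹Nonempty σ›
      exact fun h => hcone.ne_zero v (Ideal.span_eq_bot.mp h _ ⟨v, rfl⟩))
  rw [show (d : ℤ) - 2 = ((d - 1 : ℕ) : ℤ) - 1 by omega]
  exact h

end FreeHypersurface

theorem corollary1p4 {K : Type*} [Field K] [CharZero K] :
    (∀ j ∈ Finset.Icc 5 10,
      FreeHypersurface.regularity
          (FreeHypersurface.jacobianIdeal (FreeHypersurface.arrangement K j)) = 13 ∧
      -- the hypersurface `F_j = 0` in `ℙ¹⁴` is free of degree `15`, reduced and not a cone ...
      FreeHypersurface.IsFreeHypersurface (FreeHypersurface.arrangement K j) 15 ∧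
      FreeHypersurface.IsNotCone (FreeHypersurface.arrangement K j)) ∧
    -- ... and `13 = 2 * 15 - 14 - 3` is the value, for `d = 15` and `n = 14`, of the upper bound
    -- for the regularity of free hypersurfaces of degree `d` in `ℙⁿ`
    (∀ (n d : ℕ) (f : MvPolynomial (Fin (n + 1)) K),
      FreeHypersurface.IsFreeHypersurface f d → FreeHypersurface.IsNotCone f →
      FreeHypersurface.regularity (FreeHypersurface.jacobianIdeal f) ≤
        (((2 * (d : ℤ) - (n : ℤ) - 3 : ℤ) : ℝ) : EReal)) := by
  refine ⟨fun j hj => ?_, fun n d f hfree hcone => ?_⟩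
  · obtain ⟨p, q, hpq, hq, hF⟩ := FreeHypersurface.exists_arrangement_eq_fiveMinors (K := K) hj
    obtain ⟨hfree, hcone⟩ := FreeHypersurface.fiveMinors_isFreeHypersurface (K := K) hpq hq
    rw [hF]
    -- With `15` variables and `d = 15` the bounds `2d - 15 - 2` and `d - 2` coincide.
    refine ⟨le_antisymm ?_ ?_, hfree, hcone⟩
    · refine (FreeHypersurface.regularity_le_of_isFreeHypersurface hfree hcone).trans_eq ?_
      norm_num
      rfl
    · refine Eq.trans_le ?_
        (FreeHypersurface.le_regularity_jacobianIdeal hfree.homogeneous (by norm_num) hcone)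
      norm_num
      rfl
  · refine (FreeHypersurface.regularity_le_of_isFreeHypersurface hfree hcone).trans_eq ?_
    rw [Fintype.card_fin]
    congr 2
    push_cast
    ring
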